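/- **The $m$-rumor spreading model.** Fix integers $m\ge 1$, $r>m$, $s\ge m$ and a real number $d$ with $0<d\le 0.1$. A community consists of $N$ agents, where $r$ divides $N$: exactly $s$ of them are Seeds, exactly $bN$ are Agnostics, where $0\le b\le 0.25$, and the remaining $(1-b)N-s$ agents are Others. At each time every agent is either a Believer or Indifferent; Seeds are always Believers and Agnostics are always Indifferent. In each round $t=1,2,\dots$ the agents are placed by a uniformly random permutation into $N$ seats, which are divided into $N/r$ rooms of size $r$, and then simultaneously: an Other who is Indifferent becomes a Believer if its room holds at least $m$ Believers (and stays Indifferent otherwise), and an Other who is a Believer becomes Indifferent with probability $d$ (and stays a Believer otherwise). All permutations and all these random decisions are independent. Let $N_t$ be the number of Believers after round $t$; $N_0$ is the initial number. The rumor takes over at time $t$ if $N_t\ge N/2$, and it dies out at time $t$ if only the Seeds are Believers at time $t$. "A.a.s." means with probability $1-o(1)$ as $N\to\infty$ through multiples of $r$, where $m,r,s,d$ are constants and the $o(1)$ is uniform over $b\in[0,0.25]$ and over all initial sets of Believers that satisfy the stated condition. **Theorem 1.** Let $r$ and $d$ be as above. (i) Let $m=1$. There are constants $C,c>0$, depending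 only on $r$ and $d$, such that for every constant $s\ge 1$: if $N_0\ge s$, then a.a.s. the rumor takes over at some time $t\le C\log N$; and this is tight: if $N_0=s$, then a.a.s. the rumor does not take over at any time $t<c\log N$. (ii) Let $r\ge 3$. There are constants $\alpha,C,c>0$, depending only on $r$ and $d$, such that for all constants $2\le m<r$ and $s\ge m$: if $N_0\le\alpha N$, then a.a.s. the rumor dies out at some time $t\le C\log N$; and this is tight: for every constant $\beta>0$, if $N_0\ge\beta N$, then a.a.s. the rumor does not die out at any time $t<c\log N$. -/

import Mathlib

open MeasureTheory ProbabilityTheory Filter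

namespace RumorSpreading

/-- A community of `N` agents: some agents are Seeds, some are Agnostics, the remaining ones are
the Others. -/
structure Community (N : ℕ) where
  seeds : Finset (Fin N)
  agnostics : Finset (Fin N)
  disjoint_kinds : Disjoint seeds agnostics

/-- The agents that are neither Seeds nor Agnostics. -/
def Community.others {N : ℕ} (K : Community N) : Finset (Fin N) :=
  (K.seeds ∪ K.agnostics)ᶜ

/-- `B` is a possible set of Believers (all agents outside `B` are Indifferent): every Seed is a
Believer and no Agnostic is. -/
def Community.IsBelieverSet {N : ℕ} (K : Community N) (B : Finset (Fin N)) : Prop :=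
  K.seeds ⊆ B ∧ Disjoint B K.agnostics

/-- The room of agent `i` when agent `j` sits on seat `σ j`: the seats `0, …, N - 1` are grouped
into consecutive blocks of `r`, so that all rooms have exactly `r` seats when `r ∣ N`. -/
def room {N : ℕ} (r : ℕ) (σ : Equiv.Perm (Fin N)) (i : Fin N) : ℕ :=
  (σ i : ℕ) / r

/-- The number of members of `B` that are in the same room as `i`. -/
def believersInRoom {N : ℕ} (r : ℕ) (B : Finset (Fin N)) (σ : Equiv.Perm (Fin N)) (i : Fin N) : ℕ :=
  (B.filter fun j => room r σ j = room r σ i).card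

/-- The randomness of one round: the seating, and for each agent the outcome of a coin
(`true`: if the agent is an Other and a Believer, it loses interest in this round). -/
abbrev RoundOutcome (N : ℕ) : Type := Equiv.Perm (Fin N) × (Fin N → Bool)

/-- The set of Believers after one round that starts with the set `B` of Believers:
Seeds are Believers, Agnostics are not, a believing Other stays a Believer unless its coin shows
`true`, an indifferent Other becomes a Believer if its room holds at least `m` Believers. -/
def Community.nextBelievers {N : ℕ} (K : Community N) (m r : ℕ) (B : Finset (Fin N))
    (o : RoundOutcome N) : Finset (Fin N) :=
  K.seeds ∪ K.others.filter fun i =>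
    (i ∈ B ∧ o.2 i = false) ∨ (i ∉ B ∧ m ≤ believersInRoom r B o.1 i)

/-- The set of Believers after `t` rounds, starting from `B₀`; `ω t` is the randomness of round
`t + 1`. -/
def Community.believers {N : ℕ} (K : Community N) (m r : ℕ) (B₀ : Finset (Fin N))
    (ω : ℕ → RoundOutcome N) : ℕ → Finset (Fin N)
  | 0 => B₀
  | t + 1 => K.nextBelievers m r (K.believers m r B₀ ω t) (ω t)

/-- The rumor has taken over after `t` rounds: at least half of the community believes. -/
def Community.TakenOverAt {N : ℕ} (K : Community N) (m r : ℕ) (B₀ : Finset (Fin N))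
    (ω : ℕ → RoundOutcome N) (t : ℕ) : Prop :=
  (N : ℝ) / 2 ≤ ((K.believers m r B₀ ω t).card : ℝ)

/-- The rumor has died out after `t` rounds: only the Seeds believe. -/
def Community.DiedOutAt {N : ℕ} (K : Community N) (m r : ℕ) (B₀ : Finset (Fin N))
    (ω : ℕ → RoundOutcome N) (t : ℕ) : Prop :=
  K.believers m r B₀ ω t = K.seeds

instance instMeasurableSpacePerm (N : ℕ) : MeasurableSpace (Equiv.Perm (Fin N)) := ⊤

instance instDiscreteMeasurableSpacePerm (N : ℕ) :
    DiscreteMeasurableSpace (Equiv.Perm (Fin N)) := ⟨fun _ => trivial⟩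

/-- The law of one round: a uniformly random seating and independent coins showing `true` with
probability `d`, independent of the seating. -/
noncomputable def roundLaw (N : ℕ) (d : unitInterval) : Measure (RoundOutcome N) :=
  (PMF.uniformOfFintype (Equiv.Perm (Fin N))).toMeasure.prod
    (Measure.pi fun _ : Fin N => bernoulliMeasure true false d)

instance instIsProbabilityMeasureRoundLaw (N : ℕ) (d : unitInterval) :
    IsProbabilityMeasure (roundLaw N d) := by
  unfold roundLaw
  infer_instance

/-- The law of the whole process: independent rounds. -/
noncomputable def processLaw (N : ℕ) (d : unitInterval) : Measure (ℕ → RoundOutcome N) :=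
  Measure.infinitePi fun _ : ℕ => roundLaw N d

instance instIsProbabilityMeasureProcessLaw (N : ℕ) (d : unitInterval) :
    IsProbabilityMeasure (processLaw N d) := by
  unfold processLaw
  infer_instance

/-- An initial configuration of `N` agents that the model allows: rooms of size `r` fill up, there
are exactly `s` Seeds and `b * N` Agnostics for some `b ≤ 0.25`, and `B₀` is a possible set of
Believers. -/
structure IsAdmissible (r s : ℕ) (b : ℝ) {N : ℕ} (K : Community N) (B₀ : Finset (Fin N)) : Prop where
  rooms : r ∣ N
  card_seeds : K.seeds.card = s
  b_le : b ≤ 0.25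
  card_agnostics : (K.agnostics.card : ℝ) = b * N
  isBelieverSet : K.IsBelieverSet B₀

/-- An event holds asymptotically almost surely as `N → ∞`, for the process started with `N₀`
Believers for any `N₀` such that `init N N₀`: its probability is `1 - o(1)`, where the `o(1)` is
uniform over all admissible communities and initial sets of Believers. -/
def AAS (r s : ℕ) (d : unitInterval) (init : ℕ → ℕ → Prop)
    (event : ∀ {N : ℕ}, Community N → Finset (Fin N) → (ℕ → RoundOutcome N) → Prop) : Prop :=
  ∀ ε : ℝ, 0 < ε → ∀ᶠ N : ℕ in atTop,
    ∀ (b : ℝ) (K : Community N) (B₀ : Finset (Fin N)), IsAdmissible r s b K B₀ → init N B₀.card →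
      1 - ε ≤ (processLaw N d).real {ω | event K B₀ ω}

end RumorSpreading

/-! Both upper bounds rest on a potential that contracts on average by a factor γ < 1 per round.
Starting from at most N, after `horizon γ N` = Θ(log N) rounds its mean is O(1/N), while it is at
least 1 until the goal is reached. Conditioning on the first round turns this into a tail bound
(`real_chain_avoids_le`), which also tolerates a small probability per round of leaving the region
where the contraction holds.

For m = 1 the potential is N/|B|. The reciprocal, unlike the size itself, controls the random losses
even when only a constant number of agents believe. While |B| < N/2, at least N/4 Others are
Indifferent, so on average at least a quarter of the Believers have an indifferent Other on the
cyclically next seat of their room; distinct Believers convert distinct agents in this way. Chord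
bounds for the reciprocal and the independence of seating and coins then give the factor 0.98
(`integral_inv_card_nextBelievers_le`).

For m ≥ 2 the potential is the number of believing non-Seeds. A recruit needs two Believers in its
room, so the expected number of recruits is at most r²|B|²/N, which for |B| ≤ αN is dominated by the
loss d|B| once N is large (`integral_card_nextBelievers_sdiff_seeds_le_mul`). Chebyshev's inequality
for the survivors and for the meeting pairs bounds the probability of exceeding αN by O(1/N) per
round (`real_card_nextBelievers_gt_le`), which is negligible over O(log N) rounds.

The lower bounds are simpler. The number of Believers grows at most by the factor r per round,
deterministically. Conversely, ignoring recruits leaves a pure death process, in which one of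
linearly many agents survives c log N rounds with high probability
(`real_chain_survivors_eq_empty`). -/

namespace RumorSpreading

/-! ### Markov chains driven by an i.i.d. sequence, and a drift bound for hitting times -/

section Chain

variable {S Ω : Type*}

/-- The state after `t` steps of the chain that starts in `x` and is driven by `ω`. -/
def chain (step : S → Ω → S) (x : S) (ω : ℕ → Ω) : ℕ → S
  | 0 => x
  | t + 1 => step (chain step x ω t) (ω t)

theorem chain_succ_eq_shift (step : S → Ω → S) (x : S) (ω : ℕ → Ω) (t : ℕ) :
    chain step x ω (t + 1) = chain step (step x (ω 0)) (fun i => ω (i + 1)) t := by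
  induction t with
  | zero => rfl
  | succ t ih => rw [chain, ih]; rfl

theorem believers_eq_chain {N : ℕ} (K : Community N) (m r : ℕ) (B₀ : Finset (Fin N))
    (ω : ℕ → RoundOutcome N) (t : ℕ) :
    K.believers m r B₀ ω t = chain (K.nextBelievers m r) B₀ ω t := by
  induction t with
  | zero => rfl
  | succ t ih => rw [Community.believers, ih]; rfl

/-- The sequence with first term `o`, followed by the terms of `ω`. -/
def seqCons (o : Ω) (ω : ℕ → Ω) : ℕ → Ω
  | 0 => o
  | i + 1 => ω i

variable [MeasurableSpace Ω]

theorem measurable_seqCons : Measurable fun p : Ω × (ℕ → Ω) => seqCons p.1 p.2 := by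
  refine measurable_pi_lambda _ fun i => ?_
  cases i with
  | zero => exact measurable_fst
  | succ i => exact (measurable_pi_apply i).comp measurable_snd

/-- An independent first term in front of an i.i.d. sequence gives an i.i.d. sequence again. This is
the Markov property in the form needed to condition on the first round; it is checked on finite
cylinders. -/
theorem map_seqCons (μ : Measure Ω) [IsProbabilityMeasure μ] :
    (μ.prod (Measure.infinitePi fun _ : ℕ => μ)).map (fun p => seqCons p.1 p.2) =
      Measure.infinitePi fun _ : ℕ => μ := by
  classical
  refine Measure.eq_infinitePi _ fun s t ht => ?_
  rw [Measure.map_apply measurable_seqCons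
    (MeasurableSet.pi s.countable_toSet fun i _ => ht i)]
  obtain ⟨n, hn⟩ := s.exists_nat_subset_range
  -- Padding with `Set.univ` replaces the index set by an initial segment, from which index 0 splits
  -- off.
  let t' : ℕ → Set Ω := fun i => if i ∈ s then t i else Set.univ
  have ht' : ∀ i, MeasurableSet (t' i) := fun i => by
    by_cases h : i ∈ s <;> simp [t', h, ht i]
  have hpre : (fun p : Ω × (ℕ → Ω) => seqCons p.1 p.2) ⁻¹' ((s : Set ℕ).pi t) =
      t' 0 ×ˢ (((Finset.range n : Finset ℕ) : Set ℕ).pi fun i => t' (i + 1)) := by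
    ext ⟨o, ω⟩
    simp only [Set.mem_preimage, Set.mem_pi, Finset.mem_coe, Set.mem_prod, Finset.mem_range]
    constructor
    · refine fun h => ⟨?_, fun i _ => ?_⟩
      · by_cases h0 : 0 ∈ s
        · simpa [t', h0, seqCons] using h 0 h0
        · simp [t', h0]
      · by_cases h0 : i + 1 ∈ s
        · simpa [t', h0, seqCons] using h (i + 1) h0
        · simp [t', h0]
    · rintro ⟨h0, h1⟩ i hi
      cases i with
      | zero => simpa [t', hi, seqCons] using h0
      | succ i =>
        have := h1 i (by have := Finset.mem_range.1 (hn hi); omega)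
        simpa [t', hi, seqCons] using this
  rw [hpre, Measure.prod_prod, Measure.infinitePi_pi _ fun i _ => ht' (i + 1)]
  have h1 : μ (t' 0) * ∏ i ∈ Finset.range n, μ (t' (i + 1)) =
      ∏ i ∈ Finset.range (n + 1), μ (t' i) := by
    rw [Finset.prod_range_succ', mul_comm]
  rw [h1]
  have hsub : s ⊆ Finset.range (n + 1) := hn.trans (Finset.range_mono (Nat.le_succ n))
  rw [← Finset.prod_subset hsub]
  · exact Finset.prod_congr rfl fun i hi => by simp [t', hi]
  · intro i _ hi
    simp [t', hi]

variable [Finite Ω] [MeasurableSingletonClass Ω]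

theorem real_infinitePi_eq_integral (μ : Measure Ω) [IsProbabilityMeasure μ]
    {A : Set (ℕ → Ω)} (hA : MeasurableSet A) :
    (Measure.infinitePi fun _ : ℕ => μ).real A =
      ∫ o, (Measure.infinitePi fun _ : ℕ => μ).real {ω | seqCons o ω ∈ A} ∂μ := by
  have h : (Measure.infinitePi fun _ : ℕ => μ) A =
      ∫⁻ o, (Measure.infinitePi fun _ : ℕ => μ) {ω | seqCons o ω ∈ A} ∂μ := by
    conv_lhs => rw [← map_seqCons μ]
    rw [Measure.map_apply measurable_seqCons hA, Measure.prod_apply (measurable_seqCons hA)]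
    rfl
  simp only [Measure.real]
  rw [h, integral_toReal]
  · exact (measurable_of_finite _).aemeasurable
  · exact Eventually.of_forall fun o => measure_lt_top _ _

/-- Splitting over the finitely many values of the first term reduces to a shorter chain, so the
state space needs no σ-algebra. -/
theorem measurableSet_chain_mem (step : S → Ω → S) (A : Set S) (t : ℕ) (x : S) :
    MeasurableSet {ω : ℕ → Ω | chain step x ω t ∈ A} := by
  induction t generalizing x with
  | zero =>
    simp only [chain]
    exact MeasurableSet.const _
  | succ t ih =>
    have : {ω : ℕ → Ω | chain step x ω (t + 1) ∈ A} = ⋃ o : Ω, {ω : ℕ → Ω | ω 0 = o} ∩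
        (fun (ω : ℕ → Ω) i => ω (i + 1)) ⁻¹' {ω | chain step (step x o) ω t ∈ A} := by
      ext ω
      simp [chain_succ_eq_shift]
    rw [this]
    refine MeasurableSet.iUnion fun o => MeasurableSet.inter ?_ ?_
    · exact (measurable_pi_apply (X := fun _ : ℕ => Ω) 0) (measurableSet_singleton o)
    · exact (measurable_pi_lambda _ fun i => measurable_pi_apply (i + 1)) (ih _)

theorem measurableSet_chain_avoids (step : S → Ω → S) (D : Set S) (T : ℕ) (x : S) :
    MeasurableSet {ω : ℕ → Ω | ∀ t ≤ T, chain step x ω t ∉ D} := by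
  have : {ω : ℕ → Ω | ∀ t ≤ T, chain step x ω t ∉ D} =
      ⋂ t : ℕ, ⋂ _ : t ≤ T, {ω | chain step x ω t ∈ Dᶜ} := by
    ext ω; simp
  rw [this]
  exact MeasurableSet.iInter fun t => MeasurableSet.iInter fun _ =>
    measurableSet_chain_mem step _ t x

/-- If the potential `φ` contracts on average by the factor `γ` in each step from a good state
outside `D`, while good states are left with probability at most `η`, then it is unlikely that the
chain avoids `D` for a long time. -/
theorem real_chain_avoids_le (μ : Measure Ω) [IsProbabilityMeasure μ] (step : S → Ω → S)
    (D G : Set S) (φ : S → ℝ) (γ η : ℝ) (hγ : 0 ≤ γ) (hη : 0 ≤ η)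
    (hφ : ∀ x, 0 ≤ φ x) (hφD : ∀ x ∈ G, x ∉ D → 1 ≤ φ x)
    (hdrift : ∀ x ∈ G, x ∉ D → ∫ o, φ (step x o) ∂μ ≤ γ * φ x)
    (hexit : ∀ x ∈ G, x ∉ D → μ.real {o | step x o ∉ G} ≤ η) (T : ℕ) :
    ∀ x ∈ G, (Measure.infinitePi fun _ : ℕ => μ).real {ω | ∀ t ≤ T, chain step x ω t ∉ D} ≤
      γ ^ T * φ x + T * η := by
  classical
  induction T with
  | zero =>
    intro x hx
    by_cases hD : x ∈ D
    · have : {ω : ℕ → Ω | ∀ t ≤ 0, chain step x ω t ∉ D} = ∅ := by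
        ext ω; simp [chain, hD]
      rw [this]
      simpa using hφ x
    · simpa using measureReal_le_one.trans (hφD x hx hD)
  | succ T ih =>
    intro x hx
    by_cases hD : x ∈ D
    · have : {ω : ℕ → Ω | ∀ t ≤ T + 1, chain step x ω t ∉ D} = ∅ := by
        ext ω
        simp only [Set.mem_ofPred_eq, Set.mem_empty_iff_false, iff_false, not_forall, not_not]
        exact ⟨0, Nat.zero_le _, hD⟩
      rw [this]
      have := hφ x
      simp only [measureReal_empty]
      positivity
    · rw [real_infinitePi_eq_integral μ (measurableSet_chain_avoids step D (T + 1) x)]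
      -- After the first step `o`, either the state is still good and the induction hypothesis
      -- applies, or the probability is bounded by 1. The latter case is charged to an indicator of
      -- mean at most `η`.
      have hle : ∀ o, (Measure.infinitePi fun _ : ℕ => μ).real
          {ω | seqCons o ω ∈ {ω | ∀ t ≤ T + 1, chain step x ω t ∉ D}} ≤
          (γ ^ T * φ (step x o) + T * η) + {o | step x o ∉ G}.indicator 1 o := by
        intro o
        have hsub : {ω | seqCons o ω ∈ {ω | ∀ t ≤ T + 1, chain step x ω t ∉ D}} ⊆
            {ω | ∀ t ≤ T, chain step (step x o) ω t ∉ D} := by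
          intro ω hω t ht
          have := hω (t + 1) (by omega)
          rw [chain_succ_eq_shift] at this
          exact this
        by_cases ho : step x o ∈ G
        · have := (measureReal_mono hsub (measure_ne_top _ _)).trans (ih _ ho)
          simpa [ho] using this
        · have h1 : (Measure.infinitePi fun _ : ℕ => μ).real
            {ω | seqCons o ω ∈ {ω | ∀ t ≤ T + 1, chain step x ω t ∉ D}} ≤ 1 := measureReal_le_one
          have h2 : 0 ≤ γ ^ T * φ (step x o) + T * η := by
            have := hφ (step x o); positivity
          have h3 : ({o | step x o ∉ G}.indicator 1 o : ℝ) = 1 := by simp [ho]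
          rw [h3]; linarith
      refine (integral_mono .of_finite .of_finite hle).trans ?_
      rw [integral_add .of_finite .of_finite, integral_add .of_finite .of_finite,
        integral_const_mul, integral_const, integral_indicator_one (Set.toFinite _).measurableSet]
      have h1 := mul_le_mul_of_nonneg_left (hdrift x hx hD) (pow_nonneg hγ T)
      have h2 := hexit x hx hD
      simp only [probReal_univ, smul_eq_mul, one_mul]
      push_cast
      rw [pow_succ]
      linarith

end Chain

/-! ### Survivors of the coins: generating function, reciprocal moment, variance -/

section Coins

/-- The law of the coins of one round. -/
noncomputable abbrev coinLaw (N : ℕ) (d : unitInterval) : Measure (Fin N → Bool) :=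
  Measure.pi fun _ : Fin N => bernoulliMeasure true false d

/-- The members of `S` whose coin shows `false`. -/
def survivors {N : ℕ} (S : Finset (Fin N)) (c : Fin N → Bool) : Finset (Fin N) :=
  S.filter fun i => c i = false

variable {N : ℕ} (d : unitInterval) (S : Finset (Fin N))

theorem card_survivors_le (c : Fin N → Bool) : (survivors S c).card ≤ S.card :=
  Finset.card_filter_le _ _

/-- The number of survivors is binomial; its generating function factors over the independent coins.
-/
theorem integral_pow_card_survivors (x : ℝ) :
    ∫ c, x ^ (survivors S c).card ∂coinLaw N d = (d + (1 - d) * x) ^ S.card := by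
  classical
  have h (c : Fin N → Bool) : x ^ (survivors S c).card =
      ∏ i, (if i ∈ S ∧ c i = false then x else 1) := by
    rw [Finset.prod_ite]
    simp [survivors, Finset.filter_and, Finset.inter_filter]
  simp_rw [h]
  rw [integral_fintype_prod_eq_prod (μ := fun _ : Fin N => bernoulliMeasure true false d)
    (f := fun i (c : Bool) => if i ∈ S ∧ c = false then x else (1 : ℝ))]
  have h2 (i : Fin N) : ∫ c, (if i ∈ S ∧ c = false then x else (1 : ℝ))
      ∂(bernoulliMeasure true false d) = if i ∈ S then (d + (1 - d) * x : ℝ) else 1 := by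
    rw [integral_bernoulliMeasure]
    by_cases hi : i ∈ S <;> simp [hi]
  simp_rw [h2]
  rw [Finset.prod_ite]
  simp

/-- Write 1/(1 + n) as the integral of xⁿ over [0, 1], exchange the integrals and integrate the
generating function explicitly. The bound drops the nonnegative contribution of the endpoint 0. -/
theorem integral_inv_one_add_card_survivors_le (hd : (d : ℝ) < 1) :
    ∫ c, (1 + ((survivors S c).card : ℝ))⁻¹ ∂coinLaw N d ≤ ((1 - d : ℝ) * (S.card + 1))⁻¹ := by
  have hd0 : (0 : ℝ) ≤ d := d.2.1
  have h (c : Fin N → Bool) : (1 + ((survivors S c).card : ℝ))⁻¹ =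
      ∫ x in (0 : ℝ)..1, x ^ (survivors S c).card := by
    rw [integral_pow]; simp [add_comm]
  simp_rw [h]
  rw [← intervalIntegral_integral_swap]
  · simp_rw [integral_pow_card_survivors]
    have h3 (x : ℝ) : HasDerivAt
        (fun x : ℝ => (d + (1 - d) * x : ℝ) ^ (S.card + 1) / ((1 - d) * (S.card + 1)))
        ((d + (1 - d) * x : ℝ) ^ S.card) x := by
      have h4 : HasDerivAt (fun x : ℝ => (d + (1 - d) * x : ℝ)) (1 - d) x := by
        simpa using ((hasDerivAt_id x).const_mul (1 - d : ℝ)).const_add (d : ℝ)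
      convert! (h4.pow (S.card + 1)).div_const ((1 - d : ℝ) * (S.card + 1)) using 1
      have : (1 - d : ℝ) ≠ 0 := by linarith
      have : (S.card + 1 : ℝ) ≠ 0 := by positivity
      push_cast
      field_simp
    rw [intervalIntegral.integral_eq_sub_of_hasDerivAt (fun x _ => h3 x)
      (by apply Continuous.intervalIntegrable; fun_prop)]
    have h5 : 0 ≤ (d + (1 - d) * 0 : ℝ) ^ (S.card + 1) / ((1 - d) * (S.card + 1)) := by
      have : (0 : ℝ) < 1 - d := by linarith
      positivity
    have h6 : (d + (1 - d) * 1 : ℝ) = 1 := by ring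
    rw [h6, one_pow, one_div]
    linarith
  · have : IsFiniteMeasure (volume.restrict (Set.uIoc (0 : ℝ) 1)) := ⟨by simp [Set.uIoc_of_le]⟩
    refine Integrable.mono' (g := fun _ => (1 : ℝ)) (integrable_const _) ?_ ?_
    · apply Measurable.aestronglyMeasurable
      refine measurable_from_prod_countable_left fun c => ?_
      simp only [Function.uncurry_apply_pair]
      fun_prop
    · have : ∀ᵐ p ∂((volume.restrict (Set.uIoc (0 : ℝ) 1)).prod (coinLaw N d)),
          p.1 ∈ Set.uIoc (0 : ℝ) 1 := by
        refine Measure.quasiMeasurePreserving_fst.ae ?_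
        exact ae_restrict_mem measurableSet_uIoc
      filter_upwards [this] with p hp
      rw [Set.uIoc_of_le zero_le_one] at hp
      simp only [Function.uncurry, norm_pow, Real.norm_eq_abs, abs_of_pos hp.1]
      exact pow_le_one₀ hp.1.le hp.2

theorem card_survivors_eq_sum :
    (fun c => ((survivors S c).card : ℝ)) =
      ∑ i, fun c : Fin N → Bool => if i ∈ S ∧ c i = false then (1 : ℝ) else 0 := by
  ext c
  simp [survivors, Finset.filter_and, Finset.inter_filter]

theorem integral_card_survivors :
    ∫ c, ((survivors S c).card : ℝ) ∂coinLaw N d = (1 - d : ℝ) * S.card := by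
  rw [card_survivors_eq_sum]
  simp only [Finset.sum_fn]
  rw [integral_finsetSum _ fun _ _ => .of_finite]
  have h2 (i : Fin N) : ∫ c, (if i ∈ S ∧ c i = false then (1 : ℝ) else 0) ∂coinLaw N d =
      if i ∈ S then (1 - d : ℝ) else 0 := by
    rw [integral_comp_eval (μ := fun _ : Fin N => bernoulliMeasure true false d) (i := i)
      (f := fun c => if i ∈ S ∧ c = false then (1 : ℝ) else 0)
      (measurable_of_finite _).aestronglyMeasurable, integral_bernoulliMeasure]
    by_cases hi : i ∈ S <;> simp [hi]
  simp_rw [h2]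
  simp only [Finset.sum_ite_mem, Finset.univ_inter, Finset.sum_const, nsmul_eq_mul]
  ring

theorem variance_card_survivors_le :
    Var[fun c => ((survivors S c).card : ℝ); coinLaw N d] ≤ S.card := by
  rw [card_survivors_eq_sum]
  rw [variance_sum_pi (X := fun i (c : Bool) => if i ∈ S ∧ c = false then (1 : ℝ) else 0)
    fun i => .of_discrete]
  have h (i : Fin N) : Var[fun c : Bool => if i ∈ S ∧ c = false then (1 : ℝ) else 0;
      bernoulliMeasure true false d] ≤ if i ∈ S then 1 else 0 := by
    refine (variance_le_expectation_sq (measurable_of_finite _).aestronglyMeasurable).trans ?_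
    have hd0 : (0 : ℝ) ≤ d := d.2.1
    rw [integral_bernoulliMeasure]
    by_cases hi : i ∈ S <;> simp [hi, hd0]
  refine (Finset.sum_le_sum fun i _ => h i).trans ?_
  simp

theorem real_le_card_survivors_le {a : ℝ} (ha : 0 < a) :
    (coinLaw N d).real {c | (1 - d : ℝ) * S.card + a ≤ ((survivors S c).card : ℝ)} ≤
      S.card / a ^ 2 := by
  have h := meas_ge_le_variance_div_sq (μ := coinLaw N d)
    (X := fun c => ((survivors S c).card : ℝ)) .of_discrete ha
  have h1 : (coinLaw N d).real {c | (1 - d : ℝ) * S.card + a ≤ ((survivors S c).card : ℝ)} ≤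
      (coinLaw N d).real {c | a ≤ |((survivors S c).card : ℝ) -
        ∫ c, ((survivors S c).card : ℝ) ∂coinLaw N d|} := by
    refine measureReal_mono (fun c hc => ?_) (measure_ne_top _ _)
    have hc : (1 - d : ℝ) * S.card + a ≤ ((survivors S c).card : ℝ) := hc
    change a ≤ _
    rw [integral_card_survivors]
    exact le_trans (by linarith) (le_abs_self _)
  refine h1.trans ((ENNReal.toReal_le_of_le_ofReal ?_ h).trans ?_)
  · exact div_nonneg (variance_nonneg _ _) (sq_nonneg _)
  · gcongr
    exact variance_card_survivors_le d S

end Coins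

/-! ### Uniformly random seatings -/

section Seating

/-- The law of a uniformly random seating. -/
noncomputable abbrev seatingLaw (N : ℕ) : Measure (Equiv.Perm (Fin N)) :=
  (PMF.uniformOfFintype (Equiv.Perm (Fin N))).toMeasure

variable {N : ℕ}

theorem integral_seatingLaw (Q : Equiv.Perm (Fin N) → ℝ) :
    ∫ σ, Q σ ∂seatingLaw N = (N.factorial : ℝ)⁻¹ * ∑ σ, Q σ := by
  rw [PMF.integral_eq_sum, Finset.mul_sum]
  refine Finset.sum_congr rfl fun σ _ => ?_
  simp [PMF.uniformOfFintype_apply, Fintype.card_perm]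

/-- The agents on distinct given seats are a uniformly random tuple of distinct agents. -/
theorem integral_seatingLaw_embedding {ι : Type*} [Fintype ι] (f : ι ↪ Fin N)
    (Q : (ι ↪ Fin N) → ℝ) [Fintype (ι ↪ Fin N)] :
    Fintype.card (ι ↪ Fin N) * ∫ σ, Q (f.trans σ.symm.toEmbedding) ∂seatingLaw N =
      ∑ g, Q g := by
  -- Permutations act transitively on tuples of distinct seats, so the sum does not depend on the
  -- tuple. Averaging over all tuples and exchanging the sums then proves the claim.
  have key (g : ι ↪ Fin N) : ∑ σ : Equiv.Perm (Fin N), Q (f.trans σ.symm.toEmbedding) =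
      ∑ σ : Equiv.Perm (Fin N), Q (g.trans σ.symm.toEmbedding) := by
    obtain ⟨τ, hτ⟩ := Equiv.Perm.exists_extending_pair f g f.injective g.injective
    refine Fintype.sum_equiv (Equiv.mulLeft τ) _ _ fun σ => ?_
    congr 1
    ext i
    simp [← hτ, Equiv.Perm.mul_def]
  have key2 (σ : Equiv.Perm (Fin N)) :
      ∑ g : ι ↪ Fin N, Q (g.trans σ.symm.toEmbedding) = ∑ g : ι ↪ Fin N, Q g := by
    refine Fintype.sum_equiv (Equiv.embeddingCongr (Equiv.refl ι) σ.symm) _ _ fun g => ?_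
    congr 1
  have h : (Fintype.card (ι ↪ Fin N) : ℝ) *
      ∑ σ : Equiv.Perm (Fin N), Q (f.trans σ.symm.toEmbedding) = N.factorial * ∑ g, Q g := by
    calc _ = ∑ g : ι ↪ Fin N, ∑ σ : Equiv.Perm (Fin N), Q (g.trans σ.symm.toEmbedding) := by
          simp_rw [← key]; simp
      _ = _ := by
          rw [Finset.sum_comm]; simp_rw [key2]; simp [Fintype.card_perm]
  rw [integral_seatingLaw]
  have : (N.factorial : ℝ) ≠ 0 := by exact_mod_cast N.factorial_ne_zero
  field_simp
  linarith

/-- The probability that the given distinct seats are all taken by members of `B`. -/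
theorem integral_seatingLaw_forall_mem {l : ℕ} (f : Fin l ↪ Fin N) (B : Finset (Fin N)) :
    (N.descFactorial l : ℝ) * ∫ σ, (if ∀ i, σ.symm (f i) ∈ B then (1 : ℝ) else 0) ∂seatingLaw N =
      B.card.descFactorial l := by
  classical
  have h := integral_seatingLaw_embedding f (fun g => if ∀ i, g i ∈ B then (1 : ℝ) else 0)
  rw [Fintype.card_embedding_eq, Fintype.card_fin, Fintype.card_fin] at h
  refine h.trans ?_
  rw [Finset.sum_boole]
  have h2 : (Finset.univ.filter fun g : Fin l ↪ Fin N => ∀ i, g i ∈ B).card =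
      Fintype.card (Fin l ↪ B) := by
    rw [← Fintype.card_subtype]
    exact Fintype.card_congr
      { toFun := fun g => ⟨fun i => ⟨g.1 i, g.2 i⟩, fun i j hij => g.1.injective (by simpa using hij)⟩
        invFun := fun g => ⟨g.trans (Function.Embedding.subtype _), fun i => (g i).2⟩
        left_inv := fun g => by ext; rfl
        right_inv := fun g => by ext; rfl }
  rw [h2, Fintype.card_embedding_eq]
  simp

/-- The probability that two given seats are taken by a member of `B` and a member of `I`. -/
theorem integral_seatingLaw_mem_mem {p q : Fin N} (hpq : p ≠ q) {B I : Finset (Fin N)}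
    (hBI : Disjoint B I) :
    (N * (N - 1) : ℝ) *
      ∫ σ, (if σ.symm p ∈ B ∧ σ.symm q ∈ I then (1 : ℝ) else 0) ∂seatingLaw N =
      B.card * I.card := by
  classical
  have hN : 1 ≤ N := p.pos
  have hinj : Function.Injective ![p, q] := by
    intro i j; fin_cases i <;> fin_cases j <;> simp [hpq, hpq.symm]
  have h := integral_seatingLaw_embedding ⟨![p, q], hinj⟩
    (fun g => if g 0 ∈ B ∧ g 1 ∈ I then (1 : ℝ) else 0)
  rw [Fintype.card_embedding_eq, Fintype.card_fin, Fintype.card_fin] at h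
  have h3 : ((N.descFactorial 2 : ℕ) : ℝ) = N * (N - 1) := by
    simp [Nat.descFactorial, Nat.cast_sub hN, mul_comm]
  rw [h3] at h
  refine h.trans ?_
  rw [Finset.sum_boole]
  have h2 : (Finset.univ.filter fun g : Fin 2 ↪ Fin N => g 0 ∈ B ∧ g 1 ∈ I).card =
      (B ×ˢ I).card := by
    refine Finset.card_bij' (fun g _ => (g 0, g 1))
      (fun x hx => ⟨![x.1, x.2], ?_⟩) ?_ ?_ ?_ ?_
    · have hx' := Finset.mem_product.1 hx
      have : x.1 ≠ x.2 := fun h => Finset.disjoint_left.1 hBI hx'.1 (h ▸ hx'.2)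
      intro i j; fin_cases i <;> fin_cases j <;> simp [this, this.symm]
    · intro g hg; simpa using hg
    · intro x hx
      exact Finset.mem_filter.2 ⟨Finset.mem_univ _, Finset.mem_product.1 hx⟩
    · intro g hg; ext i; fin_cases i <;> rfl
    · intro x hx; rfl
  rw [h2, Finset.card_product]
  push_cast
  rfl

end Seating

/-! ### Rooms and contacts on cyclically adjacent seats -/

section Rooms

variable {N r : ℕ}

theorem card_seats_of_room_le (hr : 0 < r) (k : ℕ) :
    (Finset.univ.filter fun p : Fin N => (p : ℕ) / r = k).card ≤ r := by
  calc _ = ((Finset.univ.filter fun p : Fin N => (p : ℕ) / r = k).map Fin.valEmbedding).card :=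
        (Finset.card_map _).symm
    _ ≤ (Finset.Ico (k * r) (k * r + r)).card := by
        refine Finset.card_le_card fun x hx => ?_
        simp only [Finset.mem_map, Finset.mem_filter, Finset.mem_univ, true_and,
          Fin.valEmbedding_apply] at hx
        obtain ⟨p, hp, rfl⟩ := hx
        rw [Nat.div_eq_iff hr] at hp
        rw [Finset.mem_Ico]
        omega
    _ = r := by simp

theorem card_agents_of_room_le (hr : 0 < r) (σ : Equiv.Perm (Fin N)) (k : ℕ) :
    (Finset.univ.filter fun i : Fin N => room r σ i = k).card ≤ r := by
  refine le_trans (le_of_eq ?_) (card_seats_of_room_le (N := N) hr k)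
  refine Finset.card_bij (fun i _ => σ i) (fun i hi => ?_) (by simp) fun p hp =>
    ⟨σ.symm p, Finset.mem_filter.2 ⟨Finset.mem_univ _, ?_⟩, by simp⟩
  · exact Finset.mem_filter.2 ⟨Finset.mem_univ _, (Finset.mem_filter.1 hi).2⟩
  · simpa [room] using hp

/-- The cyclically next seat in the same room. -/
def nextSeat (hr : 0 < r) (hrN : r ∣ N) (p : Fin N) : Fin N :=
  ⟨p / r * r + (p % r + 1) % r, by
    obtain ⟨n, rfl⟩ := hrN
    have h1 : (p : ℕ) / r < n := Nat.div_lt_of_lt_mul p.2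
    have h2 := Nat.mod_lt ((p : ℕ) % r + 1) hr
    calc _ < (p : ℕ) / r * r + r := by omega
      _ = ((p : ℕ) / r + 1) * r := by ring
      _ ≤ n * r := Nat.mul_le_mul_right _ h1
      _ = r * n := mul_comm _ _⟩

theorem nextSeat_div (hr : 0 < r) (hrN : r ∣ N) (p : Fin N) :
    (nextSeat hr hrN p : ℕ) / r = p / r := by
  simp only [nextSeat]
  rw [Nat.div_eq_iff hr]
  have h2 := Nat.mod_lt ((p : ℕ) % r + 1) hr
  omega

theorem nextSeat_mod (hr : 0 < r) (hrN : r ∣ N) (p : Fin N) :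
    (nextSeat hr hrN p : ℕ) % r = (p % r + 1) % r := by
  simp [nextSeat]

theorem nextSeat_ne (hr : 1 < r) (hrN : r ∣ N) (p : Fin N) :
    p ≠ nextSeat (by omega) hrN p := by
  intro h
  have h1 := nextSeat_mod (by omega) hrN p
  rw [← h] at h1
  have h2 := Nat.mod_lt (p : ℕ) (show 0 < r by omega)
  rcases Nat.lt_or_ge ((p : ℕ) % r + 1) r with h3 | h3
  · rw [Nat.mod_eq_of_lt h3] at h1; omega
  · have h4 : (p : ℕ) % r + 1 = r := by omega
    rw [h4, Nat.mod_self] at h1; omega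

theorem nextSeat_injective (hr : 0 < r) (hrN : r ∣ N) :
    Function.Injective (nextSeat hr hrN : Fin N → Fin N) := by
  intro p q h
  have h1 := nextSeat_div hr hrN p
  have h2 := nextSeat_mod hr hrN p
  rw [h, nextSeat_div] at h1
  rw [h, nextSeat_mod] at h2
  have h3 : (p : ℕ) % r = q % r := by
    have : (q : ℕ) + 1 ≡ p + 1 [MOD r] := by
      simpa [Nat.ModEq] using h2
    exact (Nat.ModEq.add_right_cancel' 1 this).symm
  ext
  rw [← Nat.div_add_mod (p : ℕ) r, ← Nat.div_add_mod (q : ℕ) r, h1, h3]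

/-- The number of members of `B` next to whom a member of `I` sits. -/
def nextSeatContacts (hr : 0 < r) (hrN : r ∣ N) (B I : Finset (Fin N))
    (σ : Equiv.Perm (Fin N)) : ℕ :=
  (B.filter fun i => σ.symm (nextSeat hr hrN (σ i)) ∈ I).card

theorem nextSeatContacts_le_left (hr : 0 < r) (hrN : r ∣ N) (B I : Finset (Fin N))
    (σ : Equiv.Perm (Fin N)) : nextSeatContacts hr hrN B I σ ≤ B.card :=
  Finset.card_filter_le _ _

/-- The next seat is in the same room and determines its predecessor, so mapping a Believer to its
neighbour is injective and no recruit is counted twice. -/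
theorem nextSeatContacts_le (hr : 0 < r) (hrN : r ∣ N) (B I : Finset (Fin N))
    (σ : Equiv.Perm (Fin N)) :
    nextSeatContacts hr hrN B I σ ≤ (I.filter fun i => 1 ≤ believersInRoom r B σ i).card := by
  refine Finset.card_le_card_of_injOn (fun i => σ.symm (nextSeat hr hrN (σ i))) ?_ ?_
  · intro i hi
    simp only [Finset.coe_filter, Set.mem_ofPred_eq] at hi
    simp only [Finset.coe_filter, Set.mem_ofPred_eq]
    refine ⟨hi.2, Finset.card_pos.2 ⟨i, ?_⟩⟩
    simp [room, nextSeat_div, hi.1]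
  · exact (σ.symm.injective.comp ((nextSeat_injective hr hrN).comp σ.injective)).injOn

/-- Linearity of expectation over the N pairs of a seat and its successor, which are distinct
because r > 1. -/
theorem integral_nextSeatContacts (hr : 1 < r) (hrN : r ∣ N) (hN : 0 < N) {B I : Finset (Fin N)}
    (hBI : Disjoint B I) :
    (N - 1 : ℝ) * ∫ σ, (nextSeatContacts (by omega) hrN B I σ : ℝ) ∂seatingLaw N =
      B.card * I.card := by
  have h (σ : Equiv.Perm (Fin N)) : (nextSeatContacts (by omega) hrN B I σ : ℝ) =
      ∑ p, if σ.symm p ∈ B ∧ σ.symm (nextSeat (by omega) hrN p) ∈ I then (1 : ℝ) else 0 := by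
    rw [Finset.sum_boole, nextSeatContacts]
    congr 1
    exact Finset.card_bij (fun i _ => σ i) (by simp) (by simp) fun p hp =>
      ⟨σ.symm p, by simpa using hp, by simp⟩
  simp_rw [h]
  rw [integral_finsetSum _ fun _ _ => .of_finite]
  have hN' : (N : ℝ) ≠ 0 := by positivity
  refine mul_left_cancel₀ hN' ?_
  rw [← mul_assoc, Finset.mul_sum]
  simp_rw [integral_seatingLaw_mem_mem (nextSeat_ne hr hrN _) hBI]
  simp

end Rooms

theorem roundLaw_eq (N : ℕ) (d : unitInterval) :
    roundLaw N d = (seatingLaw N).prod (coinLaw N d) := rfl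

/-! ### One round of the process, and its growth if one Believer suffices -/

section NextBelievers

variable {N : ℕ} {K : Community N} {B : Finset (Fin N)} {m r : ℕ}

theorem Community.isBelieverSet_nextBelievers (o : RoundOutcome N) :
    K.IsBelieverSet (K.nextBelievers m r B o) := by
  refine ⟨Finset.subset_union_left, ?_⟩
  rw [Community.nextBelievers, Finset.disjoint_union_left]
  refine ⟨K.disjoint_kinds, ?_⟩
  rw [Finset.disjoint_left]
  intro i hi hi'
  have := (Finset.mem_filter.1 hi).1
  simp [Community.others, hi'] at this

theorem Community.IsBelieverSet.mem_others (h : K.IsBelieverSet B) {i : Fin N} (hi : i ∈ B)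
    (his : i ∉ K.seeds) : i ∈ K.others := by
  simp [Community.others, his, Finset.disjoint_left.1 h.2 hi]

theorem Community.IsBelieverSet.survivors_subset (h : K.IsBelieverSet B) (o : RoundOutcome N) :
    survivors B o.2 ⊆ K.nextBelievers m r B o := by
  intro i hi
  have hi := Finset.mem_filter.1 hi
  rw [Community.nextBelievers, Finset.mem_union]
  by_cases his : i ∈ K.seeds
  · exact Or.inl his
  · exact Or.inr (Finset.mem_filter.2 ⟨h.mem_others hi.1 his, Or.inl hi⟩)

theorem Community.IsBelieverSet.card_others_sdiff (h : K.IsBelieverSet B) :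
    (K.others \ B).card + B.card + K.agnostics.card = N := by
  have h1 : K.others \ B = (B ∪ K.agnostics)ᶜ := by
    ext i
    have := @h.1 i
    simp only [Community.others, Finset.mem_sdiff, Finset.mem_compl, Finset.mem_union]
    tauto
  have h2 := Finset.card_add_card_compl (B ∪ K.agnostics)
  rw [Finset.card_union_of_disjoint h.2, Fintype.card_fin] at h2
  rw [h1]
  omega

/-- One Seed is counted with certainty, which keeps the bound positive and gives it the form 1 +
binomial. The other Seeds are treated as if they could lose interest, which only weakens the bound.
-/
theorem Community.IsBelieverSet.le_card_nextBelievers (h : K.IsBelieverSet B) (hr : 0 < r)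
    (hrN : r ∣ N) {i₀ : Fin N} (hi₀ : i₀ ∈ K.seeds) (o : RoundOutcome N) :
    1 + (survivors (B.erase i₀) o.2).card + nextSeatContacts hr hrN B (K.others \ B) o.1 ≤
      (K.nextBelievers 1 r B o).card := by
  have h1 := nextSeatContacts_le hr hrN B (K.others \ B) o.1
  have hni : i₀ ∉ survivors (B.erase i₀) o.2 := by simp [survivors]
  have hdisj : Disjoint (insert i₀ (survivors (B.erase i₀) o.2))
      ((K.others \ B).filter fun i => 1 ≤ believersInRoom r B o.1 i) := by
    rw [Finset.disjoint_left]
    intro i hi hi'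
    refine (Finset.mem_sdiff.1 (Finset.mem_filter.1 hi').1).2 ?_
    rcases Finset.mem_insert.1 hi with rfl | hi
    · exact h.1 hi₀
    · exact Finset.mem_of_mem_erase (Finset.mem_filter.1 hi).1
  have hsub : insert i₀ (survivors (B.erase i₀) o.2) ∪
      ((K.others \ B).filter fun i => 1 ≤ believersInRoom r B o.1 i) ⊆
      K.nextBelievers 1 r B o := by
    refine Finset.union_subset (Finset.insert_subset ?_ ?_) fun i hi => ?_
    · exact Finset.mem_union_left _ hi₀
    · exact (Finset.filter_subset_filter _ (Finset.erase_subset _ _)).trans (h.survivors_subset o)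
    · have hi := Finset.mem_filter.1 hi
      have hi1 := Finset.mem_sdiff.1 hi.1
      exact Finset.mem_union_right _ (Finset.mem_filter.2 ⟨hi1.1, Or.inr ⟨hi1.2, hi.2⟩⟩)
  have := Finset.card_le_card hsub
  rw [Finset.card_union_of_disjoint hdisj, Finset.card_insert_of_notMem hni] at this
  omega

end NextBelievers

/-! ### Contraction of the reciprocal number of Believers -/

/-- A convex function lies below its chords: the reciprocal is interpolated in `j` between 0 and
`k`, then 1/(a + k) in `a` between 0 and `k`. In the result `j` and `a` occur only in products of a
function of `j` and a function of `a`, so independence applies and only the means of `j`, `a` and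
1/a are needed. -/
theorem inv_add_le_interpolation {a j k : ℝ} (ha : 0 < a) (hak : a ≤ k) (hj : 0 ≤ j) (hjk : j ≤ k) :
    (a + j)⁻¹ ≤ (1 - j / k) * a⁻¹ + j / k * (k⁻¹ * (1 - a / (2 * k))) := by
  have hk : 0 < k := by linarith
  have h1 : (a + j)⁻¹ ≤ (1 - j / k) * a⁻¹ + j / k * (a + k)⁻¹ := by
    have : (1 - j / k) * a⁻¹ + j / k * (a + k)⁻¹ - (a + j)⁻¹ =
        j * (k - j) / (a * (a + k) * (a + j)) := by
      field_simp
      ring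
    have h2 : 0 ≤ j * (k - j) / (a * (a + k) * (a + j)) := by
      have : 0 ≤ k - j := by linarith
      positivity
    linarith
  have h3 : (a + k)⁻¹ ≤ k⁻¹ * (1 - a / (2 * k)) := by
    have : k⁻¹ * (1 - a / (2 * k)) - (a + k)⁻¹ = a * (k - a) / (2 * k ^ 2 * (a + k)) := by
      field_simp
      ring
    have h2 : 0 ≤ a * (k - a) / (2 * k ^ 2 * (a + k)) := by
      have : 0 ≤ k - a := by linarith
      positivity
    linarith
  have := mul_le_mul_of_nonneg_left h3 (show 0 ≤ j / k by positivity)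
  linarith

/-- If one Believer in a room suffices, then the reciprocal of the number of Believers contracts on
average as long as the rumor has not taken over. -/
theorem integral_inv_card_nextBelievers_le {N r : ℕ} {K : Community N} {B : Finset (Fin N)}
    (d : unitInterval) (hd : (d : ℝ) ≤ 0.1) (hr : 1 < r) (hrN : r ∣ N) (hK : K.seeds.Nonempty)
    (hA : (K.agnostics.card : ℝ) ≤ 0.25 * N) (h : K.IsBelieverSet B)
    (hB : (B.card : ℝ) < N / 2) :
    ∫ o, ((K.nextBelievers 1 r B o).card : ℝ)⁻¹ ∂roundLaw N d ≤ 0.98 * (B.card : ℝ)⁻¹ := by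
  obtain ⟨i₀, hi₀⟩ := hK
  have hr0 : 0 < r := by omega
  set k : ℝ := (B.card : ℝ) with hk
  have hk1 : 1 ≤ k := by
    rw [hk]; exact_mod_cast Finset.card_pos.2 ⟨i₀, h.1 hi₀⟩
  -- `a` depends only on the coins, `j` only on the seating, and neither exceeds `k`.
  let a : (Fin N → Bool) → ℝ := fun c => 1 + ((survivors (B.erase i₀) c).card : ℝ)
  let j : Equiv.Perm (Fin N) → ℝ := fun σ => nextSeatContacts hr0 hrN B (K.others \ B) σ
  have hcard : ((B.erase i₀).card : ℝ) = k - 1 := by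
    rw [Finset.card_erase_of_mem (h.1 hi₀), Nat.cast_sub (Finset.card_pos.2 ⟨i₀, h.1 hi₀⟩)]
    simp [hk]
  have ha1 (c) : 1 ≤ a c := by simp [a]
  have hak (c) : a c ≤ k := by
    have : ((survivors (B.erase i₀) c).card : ℝ) ≤ (B.erase i₀).card := by
      exact_mod_cast card_survivors_le _ c
    simp only [a]; linarith
  have hj0 (σ) : 0 ≤ j σ := by simp [j]
  have hjk (σ) : j σ ≤ k := by
    simp only [j, hk]; exact_mod_cast nextSeatContacts_le_left hr0 hrN B _ σ
  have hpt (o : RoundOutcome N) : ((K.nextBelievers 1 r B o).card : ℝ)⁻¹ ≤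
      (1 - j o.1 / k) * (a o.2)⁻¹ + j o.1 / k * (k⁻¹ * (1 - a o.2 / (2 * k))) := by
    refine le_trans ?_ (inv_add_le_interpolation (by linarith [ha1 o.2]) (hak o.2) (hj0 o.1) (hjk o.1))
    refine inv_anti₀ (by linarith [ha1 o.2, hj0 o.1]) ?_
    simp only [a, j]
    exact_mod_cast h.le_card_nextBelievers hr0 hrN hi₀ o
  refine (integral_mono .of_finite .of_finite hpt).trans ?_
  rw [integral_add .of_finite .of_finite, roundLaw_eq,
    integral_prod_mul (fun σ => 1 - j σ / k) (fun c => (a c)⁻¹),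
    integral_prod_mul (fun σ => j σ / k) (fun c => k⁻¹ * (1 - a c / (2 * k))),
    integral_sub .of_finite .of_finite, integral_div, integral_const_mul,
    integral_sub .of_finite .of_finite, integral_div]
  simp only [integral_const, probReal_univ, smul_eq_mul, one_mul]
  have hEa : ∫ c, a c ∂coinLaw N d = 1 + (1 - d) * (k - 1) := by
    simp only [a]
    rw [integral_add .of_finite .of_finite, integral_card_survivors, hcard]
    simp
  have hEinv : ∫ c, (a c)⁻¹ ∂coinLaw N d ≤ ((1 - d) * k)⁻¹ := by
    have := integral_inv_one_add_card_survivors_le d (B.erase i₀) (by linarith)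
    rwa [hcard, sub_add_cancel] at this
  have hEj : (N - 1 : ℝ) * ∫ σ, j σ ∂seatingLaw N = k * (K.others \ B).card :=
    integral_nextSeatContacts hr hrN i₀.pos Finset.disjoint_sdiff
  have hI : ((K.others \ B).card : ℝ) + k + K.agnostics.card = N := by
    rw [hk]; exact_mod_cast h.card_others_sdiff
  set μ := (∫ σ, j σ ∂seatingLaw N) / k with hμ
  have hμ' : (N - 1 : ℝ) * μ = (K.others \ B).card := by
    rw [hμ, ← mul_div_assoc, hEj]; field_simp
  -- Fewer than N/2 Believers and at most N/4 Agnostics leave more than N/4 indifferent Others.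
  have hμ1 : 1 / 4 ≤ μ := by
    by_contra hlt
    push Not at hlt
    have : (N - 1 : ℝ) * μ ≤ (N - 1) * (1 / 4) :=
      mul_le_mul_of_nonneg_left hlt.le (by linarith)
    linarith
  have hμ2 : μ ≤ 1 := by
    rw [hμ, div_le_one (by linarith)]
    refine (integral_mono .of_finite .of_finite hjk).trans ?_
    simp
  have hd0 : (0 : ℝ) ≤ d := d.2.1
  have hEinv' : ∫ c, (a c)⁻¹ ∂coinLaw N d ≤ 10 / 9 * k⁻¹ := by
    refine hEinv.trans ?_
    rw [mul_inv]
    refine mul_le_mul_of_nonneg_right ?_ (by positivity)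
    rw [inv_le_comm₀ (by linarith) (by norm_num)]
    linarith
  have hEa' : 1 - (∫ c, a c ∂coinLaw N d) / (2 * k) ≤ 0.55 := by
    have : 0.45 ≤ (∫ c, a c ∂coinLaw N d) / (2 * k) := by
      rw [le_div_iff₀ (by positivity), hEa]
      nlinarith
    linarith
  have hk0 : 0 < k⁻¹ := by positivity
  -- The bound decreases in `μ`; at `μ` = 1/4 the factor is about 0.971.
  calc _ ≤ (1 - μ) * (10 / 9 * k⁻¹) + μ * (k⁻¹ * 0.55) :=
        add_le_add (mul_le_mul_of_nonneg_left hEinv' (by linarith))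
          (mul_le_mul_of_nonneg_left (mul_le_mul_of_nonneg_left hEa' hk0.le) (by linarith))
    _ = k⁻¹ * (10 / 9 - (10 / 9 - 0.55) * μ) := by ring
    _ ≤ k⁻¹ * 0.98 := mul_le_mul_of_nonneg_left (by linarith) hk0.le
    _ = _ := mul_comm _ _

/-! ### Logarithmic time horizons -/

section Asymptotics

/-- The number of rounds after which a quantity that shrinks by the factor `γ` in each round has
decreased from `N` to `O(1 / N)`. -/
noncomputable def horizon (γ : ℝ) (N : ℕ) : ℕ := ⌊2 / (1 - γ) * Real.log N⌋₊

theorem horizon_le {γ : ℝ} (hγ : γ < 1) (N : ℕ) : (horizon γ N : ℝ) ≤ 2 / (1 - γ) * Real.log N :=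
  Nat.floor_le (mul_nonneg (div_nonneg (by norm_num) (by linarith)) (Real.log_natCast_nonneg N))

theorem pow_horizon_mul_le {γ : ℝ} (hγ0 : 0 ≤ γ) (hγ : γ < 1) {N : ℕ} (hN : 0 < N) :
    γ ^ horizon γ N * N ≤ Real.exp 1 / N := by
  have hN' : (0 : ℝ) < N := by exact_mod_cast hN
  have hT : 2 / (1 - γ) * Real.log N < horizon γ N + 1 := Nat.lt_floor_add_one _
  have hγ1 : 0 < 1 - γ := by linarith
  have h1 : γ ≤ Real.exp (-(1 - γ)) := by
    have := Real.add_one_le_exp (-(1 - γ)); linarith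
  -- Rounding the horizon down costs at most a factor exp(1 - γ) ≤ e.
  have h2 : γ ^ horizon γ N ≤ Real.exp (1 - 2 * Real.log N) := by
    refine (pow_le_pow_left₀ hγ0 h1 _).trans ?_
    rw [← Real.exp_nat_mul, Real.exp_le_exp]
    have h3 := mul_lt_mul_of_pos_right hT hγ1
    have h4 : 2 / (1 - γ) * Real.log N * (1 - γ) = 2 * Real.log N := by field_simp
    rw [h4] at h3
    nlinarith
  refine (mul_le_mul_of_nonneg_right h2 hN'.le).trans (le_of_eq ?_)
  have h5 : Real.exp (2 * Real.log N) = N ^ 2 := by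
    rw [two_mul, Real.exp_add, Real.exp_log hN', sq]
  rw [Real.exp_sub, h5]
  field_simp

/-- An event has probability at least `1 - ε` if it happens outside an event of probability at most
`ε`. -/
theorem one_sub_le_real_of_compl_subset {Ω : Type*} [MeasurableSpace Ω] (μ : Measure Ω)
    [IsProbabilityMeasure μ] {A E : Set Ω} {ε : ℝ} (hA : MeasurableSet A) (h : μ.real A ≤ ε)
    (hAE : Aᶜ ⊆ E) : 1 - ε ≤ μ.real E := by
  have h1 := measureReal_mono hAE (measure_ne_top μ _)
  rw [probReal_compl_eq_one_sub hA] at h1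
  linarith

end Asymptotics

/-! ### Time to take over -/

/-- Take-over within `O(log N)` rounds if one Believer in a room suffices. -/
theorem aas_takeOver (r : ℕ) (d : unitInterval) (hd : (d : ℝ) ≤ 0.1) (hr : 1 < r) (s : ℕ)
    (hs : 1 ≤ s) :
    AAS r s d (fun _ N₀ => s ≤ N₀) (fun {N} K B₀ ω =>
      ∃ t : ℕ, (t : ℝ) ≤ 2 / (1 - 0.98) * Real.log N ∧ K.TakenOverAt 1 r B₀ ω t) := by
  intro ε hε
  have hlim : Tendsto (fun N : ℕ => Real.exp 1 / (N : ℝ)) atTop (nhds 0) :=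
    tendsto_const_div_atTop_nhds_zero_nat _
  filter_upwards [hlim.eventually_le_const hε, eventually_gt_atTop 0] with N hN hN0 b K B₀ hK _
  have hN0' : (0 : ℝ) < N := by exact_mod_cast hN0
  have hKne : K.seeds.Nonempty := Finset.card_pos.1 (by rw [hK.card_seeds]; omega)
  have hA : (K.agnostics.card : ℝ) ≤ 0.25 * N := by
    rw [hK.card_agnostics]
    exact mul_le_mul_of_nonneg_right hK.b_le hN0'.le
  let D : Set (Finset (Fin N)) := {B | (N : ℝ) / 2 ≤ B.card}
  let G : Set (Finset (Fin N)) := {B | K.IsBelieverSet B}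
  have hcard (B) (hB : B ∈ G) : (1 : ℝ) ≤ B.card := by
    exact_mod_cast Finset.card_pos.2 (hKne.mono hB.1)
  -- The factor N makes the potential at least 1 on every nonempty set. Believer sets are never
  -- left, so the exit probability is 0.
  have hmain := real_chain_avoids_le (roundLaw N d) (K.nextBelievers 1 r) D G
    (fun B => N * (B.card : ℝ)⁻¹) 0.98 0 (by norm_num) le_rfl (fun B => by positivity)
    (fun B hB _ => by
      have h1 := hcard B hB
      have h2 : (B.card : ℝ) ≤ N := by
        exact_mod_cast (Finset.card_le_univ B).trans (by simp)
      rw [← div_eq_mul_inv, one_le_div (by linarith)]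
      exact h2)
    (fun B hB hBD => by
      rw [integral_const_mul]
      have := integral_inv_card_nextBelievers_le d hd hr hK.rooms hKne hA hB
        (not_le.1 hBD)
      calc _ ≤ (N : ℝ) * (0.98 * (B.card : ℝ)⁻¹) := mul_le_mul_of_nonneg_left this hN0'.le
        _ = _ := by ring)
    (fun B hB _ => by
      have : {o | K.nextBelievers 1 r B o ∉ G} = ∅ := by
        ext o
        simpa [G] using Community.isBelieverSet_nextBelievers o
      rw [this]; simp)
    (horizon 0.98 N) B₀ hK.isBelieverSet
  refine one_sub_le_real_of_compl_subset (processLaw N d)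
    (A := {ω | ∀ t ≤ horizon 0.98 N, chain (K.nextBelievers 1 r) B₀ ω t ∉ D})
    (measurableSet_chain_avoids _ _ _ _) ?_ ?_
  · refine hmain.trans (le_trans ?_ hN)
    refine le_trans ?_ (pow_horizon_mul_le (γ := 0.98) (by norm_num) (by norm_num) hN0)
    have h1 := hcard B₀ hK.isBelieverSet
    rw [mul_zero, add_zero]
    refine mul_le_mul_of_nonneg_left ?_ (by positivity)
    exact mul_le_of_le_one_right hN0'.le (inv_le_one_of_one_le₀ h1)
  · intro ω hω
    have hω : ¬ ∀ t ≤ horizon 0.98 N, chain (K.nextBelievers 1 r) B₀ ω t ∉ D := hω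
    push Not at hω
    obtain ⟨t, ht, htD⟩ := hω
    refine ⟨t, le_trans (by exact_mod_cast ht) (horizon_le (by norm_num) N), ?_⟩
    rw [Community.TakenOverAt, believers_eq_chain]
    exact htD

/-- Every new Believer shares its room with an old one, and a room has at most `r` agents. -/
theorem Community.card_nextBelievers_le_mul {N r m : ℕ} {K : Community N} {B : Finset (Fin N)}
    (hr : 0 < r) (hm : 1 ≤ m) (h : K.IsBelieverSet B) (o : RoundOutcome N) :
    (K.nextBelievers m r B o).card ≤ B.card * r := by
  have hsub : K.nextBelievers m r B o ⊆
      B.biUnion fun i => Finset.univ.filter fun j => room r o.1 j = room r o.1 i := by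
    intro i hi
    rw [Finset.mem_biUnion]
    by_cases hiB : i ∈ B
    · exact ⟨i, hiB, by simp⟩
    · rcases Finset.mem_union.1 hi with his | hi
      · exact absurd (h.1 his) hiB
      · have hroom : m ≤ believersInRoom r B o.1 i := by
          rcases (Finset.mem_filter.1 hi).2 with h1 | h1
          · exact absurd h1.1 hiB
          · exact h1.2
        obtain ⟨j, hj⟩ := Finset.card_pos.1 (hm.trans hroom)
        exact ⟨j, (Finset.mem_filter.1 hj).1, by simp [(Finset.mem_filter.1 hj).2]⟩
  exact (Finset.card_le_card hsub).trans
    (Finset.card_biUnion_le_card_mul _ _ _ fun i _ => card_agents_of_room_le hr _ _)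

theorem Community.card_believers_le_mul_pow {N r m : ℕ} {K : Community N} {B₀ : Finset (Fin N)}
    (hr : 0 < r) (hm : 1 ≤ m) (h : K.IsBelieverSet B₀) (ω : ℕ → RoundOutcome N) (t : ℕ) :
    K.IsBelieverSet (K.believers m r B₀ ω t) ∧
      (K.believers m r B₀ ω t).card ≤ B₀.card * r ^ t := by
  induction t with
  | zero => exact ⟨h, by simp [Community.believers]⟩
  | succ t ih =>
    refine ⟨Community.isBelieverSet_nextBelievers _,
      (Community.card_nextBelievers_le_mul hr hm ih.1 _).trans ?_⟩
    rw [pow_succ, ← mul_assoc]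
    exact Nat.mul_le_mul_right _ ih.2

/-- No take-over before `Ω(log N)` rounds from constantly many Believers. -/
theorem aas_not_takeOver_early (r : ℕ) (d : unitInterval) (hr : 1 < r) (s : ℕ) (hs : 1 ≤ s) :
    AAS r s d (fun _ N₀ => N₀ = s) (fun {N} K B₀ ω =>
      ∀ t : ℕ, K.TakenOverAt 1 r B₀ ω t → 1 / (2 * Real.log r) * Real.log N ≤ (t : ℝ)) := by
  intro ε hε
  -- From N ≤ 2s·r^t, the part log(2s) is at most half of log N once N ≥ (2s)²; the other half
  -- explains the 2 in the constant. The event is then certain.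
  filter_upwards [eventually_ge_atTop ((2 * s) ^ 2), eventually_gt_atTop 0]
    with N hN hN0 b K B₀ hK hB₀
  have hN0' : (0 : ℝ) < N := by exact_mod_cast hN0
  have hlog : 0 < Real.log r := Real.log_pos (by exact_mod_cast hr)
  have hall : ∀ (ω : ℕ → RoundOutcome N) (t : ℕ), K.TakenOverAt 1 r B₀ ω t →
      1 / (2 * Real.log r) * Real.log N ≤ (t : ℝ) := by
    intro ω t ht
    have h1 := (Community.card_believers_le_mul_pow (m := 1) (by omega : 0 < r) le_rfl
      hK.isBelieverSet ω t).2
    rw [hB₀] at h1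
    have h2 : (N : ℝ) ≤ 2 * s * (r : ℝ) ^ t := by
      have h3 : ((K.believers 1 r B₀ ω t).card : ℝ) ≤ s * (r : ℝ) ^ t := by exact_mod_cast h1
      have : (N : ℝ) / 2 ≤ ((K.believers 1 r B₀ ω t).card : ℝ) := ht
      linarith
    have hs' : (0 : ℝ) < 2 * s := by positivity
    have hr' : (0 : ℝ) < r := by positivity
    have h4 := Real.log_le_log hN0' h2
    rw [Real.log_mul hs'.ne' (by positivity), Real.log_pow] at h4
    have h5 : 2 * Real.log (2 * s) ≤ Real.log N := by
      have : Real.log ((2 * s : ℝ) ^ 2) ≤ Real.log N :=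
        Real.log_le_log (by positivity) (by exact_mod_cast hN)
      rw [Real.log_pow] at this
      exact_mod_cast this
    rw [one_div, inv_mul_le_iff₀ (by positivity)]
    linarith
  have : {ω : ℕ → RoundOutcome N | ∀ t : ℕ, K.TakenOverAt 1 r B₀ ω t →
      1 / (2 * Real.log r) * Real.log N ≤ (t : ℝ)} = Set.univ :=
    Set.eq_univ_of_forall fun ω => hall ω
  rw [this, probReal_univ]
  linarith

/-! ### The pure death process and the lower bound on the extinction time -/

/-- Each agent independently outlives `T` rounds with probability (1 - d)^T. In the induction, one
round substitutes d + (1 - d)x for x in the generating function, which sends 1 - (1 - d)^T to 1 - (1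
- d)^(T + 1). -/
theorem real_chain_survivors_eq_empty {N : ℕ} (d : unitInterval) (T : ℕ) (S : Finset (Fin N)) :
    (processLaw N d).real {ω | chain (fun S o => survivors S o.2) S ω T ∈ ({∅} : Set _)} =
      (1 - (1 - d : ℝ) ^ T) ^ S.card := by
  classical
  induction T generalizing S with
  | zero =>
    simp only [chain, Set.mem_singleton_iff, pow_zero, sub_self]
    by_cases hS : S = ∅
    · simp [hS]
    · have : S.card ≠ 0 := by simpa using hS
      simp [hS]
  | succ T ih =>
    have h1 := real_infinitePi_eq_integral (roundLaw N d)
      (measurableSet_chain_mem (fun S (o : RoundOutcome N) => survivors S o.2) {∅} (T + 1) S)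
    refine h1.trans ?_
    have h2 (o : RoundOutcome N) : (Measure.infinitePi fun _ : ℕ => roundLaw N d).real
        {ω | seqCons o ω ∈ {ω | chain (fun S (o : RoundOutcome N) => survivors S o.2) S ω (T + 1) ∈
          ({∅} : Set (Finset (Fin N)))}} = (1 - (1 - d : ℝ) ^ T) ^ (survivors S o.2).card := by
      refine Eq.trans ?_ (ih (survivors S o.2))
      congr 1
      ext ω
      simp only [Set.mem_ofPred_eq, chain_succ_eq_shift]
      rfl
    simp_rw [h2]
    rw [roundLaw_eq, integral_fun_snd (fun c => (1 - (1 - d : ℝ) ^ T) ^ (survivors S c).card),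
      integral_pow_card_survivors, probReal_univ, one_smul]
    ring

theorem chain_survivors_subset {N : ℕ} (S : Finset (Fin N)) (ω : ℕ → RoundOutcome N) (t : ℕ) :
    chain (fun S o => survivors S o.2) S ω t ⊆ S := by
  induction t with
  | zero => exact subset_rfl
  | succ t ih => exact (Finset.filter_subset _ _).trans ih

theorem chain_survivors_antitone {N : ℕ} (S : Finset (Fin N)) (ω : ℕ → RoundOutcome N) :
    Antitone (chain (fun S o => survivors S o.2) S ω) :=
  antitone_nat_of_succ_le fun _ => Finset.filter_subset _ _

/-- Coupling with the same coins: recruits and the loyalty of Seeds only add Believers to the death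
process. -/
theorem Community.IsBelieverSet.chain_survivors_subset_believers {N m r : ℕ} {K : Community N}
    {B₀ S : Finset (Fin N)} (h : K.IsBelieverSet B₀) (hS : S ⊆ B₀) (ω : ℕ → RoundOutcome N)
    (t : ℕ) : K.IsBelieverSet (K.believers m r B₀ ω t) ∧
      chain (fun S o => survivors S o.2) S ω t ⊆ K.believers m r B₀ ω t := by
  induction t with
  | zero => exact ⟨h, hS⟩
  | succ t ih =>
    exact ⟨Community.isBelieverSet_nextBelievers _,
      (Finset.filter_subset_filter _ ih.2).trans (ih.1.survivors_subset _)⟩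

/-- No extinction before `Ω(log N)` rounds from a linear number of Believers. -/
theorem aas_not_dieOut_early (m r : ℕ) (d : unitInterval) (hd0 : (0 : ℝ) < d) (hd : (d : ℝ) < 1)
    (s : ℕ) {β : ℝ} (hβ : 0 < β) :
    AAS r s d (fun N N₀ => β * N ≤ (N₀ : ℝ)) (fun {N} K B₀ ω =>
      ∀ t : ℕ, K.DiedOutAt m r B₀ ω t → 1 / (-2 * Real.log (1 - d)) * Real.log N ≤ (t : ℝ)) := by
  intro ε hε
  have hlog : Real.log (1 - d) < 0 := Real.log_neg (by linarith) (by linarith)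
  have hsqrt : Tendsto (fun N : ℕ => Real.sqrt N) atTop atTop :=
    Real.tendsto_sqrt_atTop.comp tendsto_natCast_atTop_atTop
  have hlim : Tendsto (fun N : ℕ => Real.exp (-(β * Real.sqrt N + (-s : ℝ)))) atTop (nhds 0) :=
    Real.tendsto_exp_neg_atTop_nhds_zero.comp
      (tendsto_atTop_add_const_right _ _ (hsqrt.const_mul_atTop hβ))
  filter_upwards [hlim.eventually_le_const hε, eventually_ge_atTop 1] with N hN hN1 b K B₀ hK hB₀
  have hN1' : (1 : ℝ) ≤ N := by exact_mod_cast hN1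
  -- Chosen so that (1 - d)^(c log N) = 1/√N. At least βN - s non-Seeds then all lose interest with
  -- probability at most exp(-(β√N - s)).
  set c : ℝ := 1 / (-2 * Real.log (1 - d)) with hc
  have hc0 : 0 ≤ c := by rw [hc]; exact div_nonneg zero_le_one (by linarith)
  set T := ⌊c * Real.log N⌋₊ with hT
  refine one_sub_le_real_of_compl_subset (processLaw N d)
    (A := {ω | chain (fun S o => survivors S o.2) (B₀ \ K.seeds) ω T ∈ ({∅} : Set _)})
    (measurableSet_chain_mem _ _ _ _) ?_ ?_
  · rw [real_chain_survivors_eq_empty]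
    refine le_trans ?_ hN
    have hsq : 1 ≤ Real.sqrt N := Real.one_le_sqrt.2 hN1'
    have hss : Real.sqrt N * Real.sqrt N = N := Real.mul_self_sqrt (by linarith)
    have h1 : (Real.sqrt N)⁻¹ ≤ (1 - d : ℝ) ^ T := by
      have h2 : (1 - d : ℝ) ^ T = Real.exp (T * Real.log (1 - d)) := by
        rw [Real.exp_nat_mul, Real.exp_log (by linarith)]
      have h3 : (T : ℝ) ≤ c * Real.log N :=
        Nat.floor_le (mul_nonneg hc0 (Real.log_natCast_nonneg N))
      have h4 : (Real.sqrt N)⁻¹ = Real.exp (c * Real.log N * Real.log (1 - d)) := by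
        have : c * Real.log N * Real.log (1 - d) = -(Real.log N / 2) := by
          have hne := hlog.ne
          rw [hc]; field_simp
        rw [this, Real.exp_neg, ← Real.log_sqrt (by linarith), Real.exp_log (by linarith)]
      rw [h2, h4, Real.exp_le_exp]
      exact mul_le_mul_of_nonpos_right h3 hlog.le
    have h5 : (1 - d : ℝ) ^ T ≤ 1 := pow_le_one₀ (by linarith) (by linarith)
    have hcard : β * N - s ≤ ((B₀ \ K.seeds).card : ℝ) := by
      rw [Finset.card_sdiff_of_subset hK.isBelieverSet.1,
        Nat.cast_sub (Finset.card_le_card hK.isBelieverSet.1), hK.card_seeds]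
      linarith
    calc (1 - (1 - d : ℝ) ^ T) ^ (B₀ \ K.seeds).card
        ≤ Real.exp (-(1 - d : ℝ) ^ T) ^ (B₀ \ K.seeds).card := by
          refine pow_le_pow_left₀ (by linarith) ?_ _
          have := Real.add_one_le_exp (-(1 - d : ℝ) ^ T)
          linarith
      _ = Real.exp (-((B₀ \ K.seeds).card * (1 - d : ℝ) ^ T)) := by
          rw [← Real.exp_nat_mul]; ring_nf
      _ ≤ _ := by
          rw [Real.exp_le_exp, neg_le_neg_iff]
          have h6 : ((B₀ \ K.seeds).card : ℝ) * (Real.sqrt N)⁻¹ ≤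
              (B₀ \ K.seeds).card * (1 - d : ℝ) ^ T :=
            mul_le_mul_of_nonneg_left h1 (Nat.cast_nonneg _)
          refine le_trans ?_ h6
          rw [← div_eq_mul_inv, le_div_iff₀ (by linarith)]
          have hs0 : (0 : ℝ) ≤ s := Nat.cast_nonneg s
          have : (s : ℝ) ≤ s * Real.sqrt N := le_mul_of_one_le_right hs0 hsq
          calc _ = β * (Real.sqrt N * Real.sqrt N) - s * Real.sqrt N := by ring
            _ ≤ _ := by rw [hss]; linarith
  · intro ω hω t ht
    by_contra hlt
    push Not at hlt
    refine hω (?_ : _ = _)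
    have htT : t ≤ T := Nat.le_floor hlt.le
    rw [← Finset.subset_empty]
    -- At extinction a survivor would have to be a Seed, but the death process starts outside the
    -- Seeds. Hence it is empty at time `t`, and remains so until `T`.
    refine (chain_survivors_antitone _ ω htT).trans fun i hi => ?_
    have h1 := (hK.isBelieverSet.chain_survivors_subset_believers (m := m) (r := r)
      Finset.sdiff_subset ω t).2 hi
    have h2 := Finset.mem_sdiff.1 (chain_survivors_subset _ ω t hi)
    rw [(ht : _ = _)] at h1
    exact absurd h1 h2.2

/-! ### Pairs of Believers in the same room: mean, variance, concentration -/

section RoomPairs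

/-- The ordered pairs of different seats in the same room. -/
def roomPairs (N r : ℕ) : Finset (Fin N × Fin N) :=
  Finset.univ.filter fun e => e.1 ≠ e.2 ∧ (e.1 : ℕ) / r = e.2 / r

/-- The number of ordered pairs of different members of `B` in the same room. -/
def meetings {N : ℕ} (r : ℕ) (B : Finset (Fin N)) (σ : Equiv.Perm (Fin N)) : ℕ :=
  ((roomPairs N r).filter fun e => σ.symm e.1 ∈ B ∧ σ.symm e.2 ∈ B).card

variable {N r : ℕ} (B : Finset (Fin N))

theorem card_roomPairs_le (hr : 0 < r) : (roomPairs N r).card ≤ N * r := by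
  have hsub : roomPairs N r ⊆ (Finset.univ : Finset (Fin N)).biUnion fun p =>
      {p} ×ˢ Finset.univ.filter fun q : Fin N => (q : ℕ) / r = p / r := by
    intro e he
    exact Finset.mem_biUnion.2 ⟨e.1, Finset.mem_univ _, Finset.mem_product.2
      ⟨Finset.mem_singleton_self _, Finset.mem_filter.2
        ⟨Finset.mem_univ _, (Finset.mem_filter.1 he).2.2.symm⟩⟩⟩
  refine (Finset.card_le_card hsub).trans ?_
  refine (Finset.card_biUnion_le_card_mul _ _ r fun p _ => ?_).trans (by simp)
  rw [Finset.card_product, Finset.card_singleton, one_mul]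
  exact card_seats_of_room_le hr _

/-- The indicator of the event that both seats of the pair `e` are taken by members of `B`. -/
noncomputable def meet (e : Fin N × Fin N) (σ : Equiv.Perm (Fin N)) : ℝ :=
  if σ.symm e.1 ∈ B ∧ σ.symm e.2 ∈ B then 1 else 0

theorem meetings_eq_sum (σ : Equiv.Perm (Fin N)) :
    (meetings r B σ : ℝ) = ∑ e ∈ roomPairs N r, meet B e σ := by
  simp only [meet, Finset.sum_boole, meetings]

/-- The probability that two given seats are both taken by members of `B`. -/
noncomputable def meetProb : ℝ := B.card * (B.card - 1) / (N * (N - 1))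

theorem integral_meet {e : Fin N × Fin N} (he : e.1 ≠ e.2) :
    ∫ σ, meet B e σ ∂seatingLaw N = meetProb B := by
  have hinj : Function.Injective ![e.1, e.2] := by
    intro i j; fin_cases i <;> fin_cases j <;> simp [he, he.symm]
  have h := integral_seatingLaw_forall_mem ⟨![e.1, e.2], hinj⟩ B
  have hN : 2 ≤ N := by simpa using Fintype.card_le_of_injective _ hinj
  have hN' : (2 : ℝ) ≤ N := by exact_mod_cast hN
  simp only [Nat.cast_descFactorial_two, Function.Embedding.coeFn_mk, Fin.forall_fin_two,
    Matrix.cons_val_zero, Matrix.cons_val_one] at h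
  rw [meetProb, eq_div_iff (by nlinarith), mul_comm]
  exact h

/-- Seating is sampling without replacement, so pairs on four distinct seats are not positively
correlated: (k - 2)/(N - 2) ≤ k/N and (k - 3)/(N - 3) ≤ (k - 1)/(N - 1) for k = |B| ≤ N. -/
theorem integral_meet_mul_meet_le {e e' : Fin N × Fin N}
    (h : Function.Injective ![e.1, e.2, e'.1, e'.2]) :
    ∫ σ, meet B e σ * meet B e' σ ∂seatingLaw N ≤ meetProb B ^ 2 := by
  have hfun (σ : Equiv.Perm (Fin N)) : meet B e σ * meet B e' σ =
      if ∀ i, σ.symm ((⟨![e.1, e.2, e'.1, e'.2], h⟩ : Fin 4 ↪ Fin N) i) ∈ B then 1 else 0 := by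
    simp only [meet, Fin.forall_fin_succ, Function.Embedding.coeFn_mk]
    simp [← ite_and, and_assoc]
    exact if_congr (by tauto) rfl rfl
  simp_rw [hfun]
  have h4 := integral_seatingLaw_forall_mem ⟨![e.1, e.2, e'.1, e'.2], h⟩ B
  set E := ∫ σ, (if ∀ i, σ.symm ((⟨![e.1, e.2, e'.1, e'.2], h⟩ : Fin 4 ↪ Fin N) i) ∈ B
    then (1 : ℝ) else 0) ∂seatingLaw N
  have hN : 4 ≤ N := by simpa using Fintype.card_le_of_injective _ h
  have hkN : B.card ≤ N := by simpa using Finset.card_le_univ B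
  have hcast (n : ℕ) (hn : 4 ≤ n) : (n.descFactorial 4 : ℝ) = n * (n - 1) * ((n - 2) * (n - 3)) := by
    simp only [Nat.descFactorial, Nat.cast_mul, Nat.cast_sub (show 3 ≤ n by omega),
      Nat.cast_sub (show 2 ≤ n by omega), Nat.cast_sub (show 1 ≤ n by omega)]
    push_cast; simp; ring
  have hN' : (4 : ℝ) ≤ N := by exact_mod_cast hN
  have hkN' : (B.card : ℝ) ≤ N := by exact_mod_cast hkN
  have hpos : (0 : ℝ) < N.descFactorial 4 := by
    exact_mod_cast Nat.descFactorial_pos.2 hN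
  rcases Nat.lt_or_ge B.card 4 with hk | hk
  · rw [Nat.descFactorial_eq_zero_iff_lt.2 hk, Nat.cast_zero] at h4
    rcases mul_eq_zero.1 h4 with h0 | h0
    · exact absurd h0 hpos.ne'
    · rw [h0]; positivity
  · have hk' : (4 : ℝ) ≤ B.card := by exact_mod_cast hk
    rw [hcast N hN, hcast _ hk] at h4
    have hE : E = B.card * (B.card - 1) / (N * (N - 1)) *
        ((B.card - 2) * (B.card - 3) / ((N - 2) * (N - 3))) := by
      rw [div_mul_div_comm, eq_div_iff, mul_comm, h4]
      have h1 : (0 : ℝ) < N - 1 := by linarith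
      have h2 : (0 : ℝ) < N - 2 := by linarith
      have h3 : (0 : ℝ) < N - 3 := by linarith
      positivity
    rw [hE, meetProb, sq]
    have h1 : (0 : ℝ) < N - 1 := by linarith
    have h2 : (0 : ℝ) < N - 2 := by linarith
    have h3 : (0 : ℝ) < N - 3 := by linarith
    have h1' : (0 : ℝ) < B.card - 1 := by linarith
    have h2' : (0 : ℝ) < B.card - 2 := by linarith
    have h3' : (0 : ℝ) < B.card - 3 := by linarith
    refine mul_le_mul_of_nonneg_left ?_ (by positivity)
    rw [mul_div_mul_comm, mul_div_mul_comm]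
    refine mul_le_mul ?_ ?_ (by positivity) (by positivity)
    · rw [div_le_div_iff₀ h2 (by linarith)]; nlinarith
    · rw [div_le_div_iff₀ h3 h1]; nlinarith

theorem meetProb_nonneg : 0 ≤ meetProb B := by
  rw [meetProb]
  have key (n : ℕ) : (0 : ℝ) ≤ n * (n - 1) := by
    rw [← Nat.cast_descFactorial_two]; positivity
  exact div_nonneg (key _) (key _)

theorem meetProb_le : meetProb B ≤ (B.card / N : ℝ) ^ 2 := by
  have hkN : (B.card : ℝ) ≤ N := by
    exact_mod_cast (Finset.card_le_univ B).trans (by simp)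
  rcases Nat.lt_or_ge N 2 with hN | hN
  · have : (N : ℝ) * (N - 1) = 0 := by interval_cases N <;> simp
    rw [meetProb, this, div_zero]; positivity
  · have hN' : (2 : ℝ) ≤ N := by exact_mod_cast hN
    rw [meetProb, mul_div_mul_comm, sq]
    refine mul_le_mul_of_nonneg_left ?_ (by positivity)
    rw [div_le_div_iff₀ (by linarith) (by linarith)]
    nlinarith

theorem integral_meetings :
    ∫ σ, (meetings r B σ : ℝ) ∂seatingLaw N = (roomPairs N r).card * meetProb B := by
  simp_rw [meetings_eq_sum]
  rw [integral_finsetSum _ fun _ _ => .of_finite,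
    Finset.sum_congr rfl fun e he => integral_meet B (Finset.mem_filter.1 he).2.1]
  simp

theorem integral_meetings_le (hr : 0 < r) :
    ∫ σ, (meetings r B σ : ℝ) ∂seatingLaw N ≤ r * B.card ^ 2 / N := by
  rw [integral_meetings]
  have h1 : ((roomPairs N r).card : ℝ) ≤ N * r := by exact_mod_cast card_roomPairs_le hr
  refine (mul_le_mul h1 (meetProb_le B) (meetProb_nonneg B) (by positivity)).trans (le_of_eq ?_)
  rcases Nat.eq_zero_or_pos N with rfl | hN
  · simp
  · have : (N : ℝ) ≠ 0 := by positivity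
    field_simp

/-- Only pairs of seats in the same room can contribute positive covariance. Each of the at most Nr
pairs has at most r² such partners, and each contributes at most 1. -/
theorem variance_meetings_le (hr : 0 < r) :
    Var[fun σ => (meetings r B σ : ℝ); seatingLaw N] ≤ N * r ^ 3 := by
  classical
  rw [variance_eq_sub .of_discrete]
  let near (e : Fin N × Fin N) : Finset (Fin N × Fin N) :=
    (Finset.univ.filter fun q : Fin N => (q : ℕ) / r = e.1 / r) ×ˢ
      Finset.univ.filter fun q : Fin N => (q : ℕ) / r = e.1 / r
  have hnear (e : Fin N × Fin N) : (near e).card ≤ r ^ 2 := by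
    simp only [near, Finset.card_product, sq]
    exact Nat.mul_le_mul (card_seats_of_room_le hr _) (card_seats_of_room_le hr _)
  have hpair (e) (he : e ∈ roomPairs N r) (e') (he' : e' ∈ roomPairs N r) :
      ∫ σ, meet B e σ * meet B e' σ ∂seatingLaw N ≤
        meetProb B ^ 2 + if e' ∈ near e then 1 else 0 := by
    have he := (Finset.mem_filter.1 he).2
    have he' := (Finset.mem_filter.1 he').2
    by_cases hn : e' ∈ near e
    · simp only [hn, if_true]
      have : ∫ σ, meet B e σ * meet B e' σ ∂seatingLaw N ≤ ∫ _, (1 : ℝ) ∂seatingLaw N := by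
        refine integral_mono .of_finite .of_finite fun σ => ?_
        simp only [meet]
        split_ifs <;> norm_num
      rw [integral_const, probReal_univ, one_smul] at this
      nlinarith [sq_nonneg (meetProb B)]
    · simp only [hn, if_false, add_zero]
      refine integral_meet_mul_meet_le B ?_
      simp only [near, Finset.mem_product, Finset.mem_filter, Finset.mem_univ, true_and,
        ← he'.2, and_self] at hn
      have h1 : e.1 ≠ e'.1 := fun h => hn (by rw [h])
      have h2 : e.1 ≠ e'.2 := fun h => hn (by rw [h, he'.2])
      have h3 : e.2 ≠ e'.1 := fun h => hn (by rw [he.2, h])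
      have h4 : e.2 ≠ e'.2 := fun h => hn (by rw [he.2, h, he'.2])
      intro i j
      fin_cases i <;> fin_cases j <;>
        simp [he.1, he'.1, h1, h2, h3, h4, he.1.symm, he'.1.symm, h1.symm, h2.symm, h3.symm,
          h4.symm]
  have hsq : ∫ σ, (meetings r B σ : ℝ) ^ 2 ∂seatingLaw N =
      ∑ e ∈ roomPairs N r, ∑ e' ∈ roomPairs N r, ∫ σ, meet B e σ * meet B e' σ ∂seatingLaw N := by
    simp_rw [meetings_eq_sum, sq, Finset.sum_mul_sum]
    rw [integral_finsetSum _ fun _ _ => .of_finite]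
    exact Finset.sum_congr rfl fun e _ => integral_finsetSum _ fun _ _ => .of_finite
  have hinner (e) (he : e ∈ roomPairs N r) :
      ∑ e' ∈ roomPairs N r, ∫ σ, meet B e σ * meet B e' σ ∂seatingLaw N ≤
        (roomPairs N r).card * meetProb B ^ 2 + r ^ 2 := by
    refine (Finset.sum_le_sum fun e' he' => hpair e he e' he').trans ?_
    rw [Finset.sum_add_distrib, Finset.sum_const, nsmul_eq_mul, Finset.sum_boole]
    have h1 : ((roomPairs N r).filter fun e' => e' ∈ near e).card ≤ r ^ 2 :=
      (Finset.card_le_card fun e' he' => (Finset.mem_filter.1 he').2).trans (hnear e)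
    have h2 : (((roomPairs N r).filter fun e' => e' ∈ near e).card : ℝ) ≤ r ^ 2 := by
      exact_mod_cast h1
    linarith
  have htotal := Finset.sum_le_sum hinner
  have hP : ((roomPairs N r).card : ℝ) ≤ N * r := by exact_mod_cast card_roomPairs_le hr
  rw [Finset.sum_const, nsmul_eq_mul] at htotal
  have h1 : ∫ σ, ((fun σ => (meetings r B σ : ℝ)) ^ 2) σ ∂seatingLaw N =
      ∫ σ, (meetings r B σ : ℝ) ^ 2 ∂seatingLaw N := rfl
  rw [h1, hsq, integral_meetings]
  have h2 : ((roomPairs N r).card : ℝ) * r ^ 2 ≤ N * r * r ^ 2 :=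
    mul_le_mul_of_nonneg_right hP (by positivity)
  calc _ ≤ ((roomPairs N r).card : ℝ) * ((roomPairs N r).card * meetProb B ^ 2 + r ^ 2) -
        ((roomPairs N r).card * meetProb B) ^ 2 := sub_le_sub_right htotal _
    _ = (roomPairs N r).card * r ^ 2 := by ring
    _ ≤ N * r * r ^ 2 := h2
    _ = _ := by ring

theorem real_le_meetings_le (hr : 0 < r) {a : ℝ} (ha : 0 < a) :
    (seatingLaw N).real {σ | r * B.card ^ 2 / N + a ≤ (meetings r B σ : ℝ)} ≤
      N * r ^ 3 / a ^ 2 := by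
  have h := meas_ge_le_variance_div_sq (μ := seatingLaw N)
    (X := fun σ => (meetings r B σ : ℝ)) .of_discrete ha
  have h1 : (seatingLaw N).real {σ | r * B.card ^ 2 / N + a ≤ (meetings r B σ : ℝ)} ≤
      (seatingLaw N).real {σ | a ≤ |(meetings r B σ : ℝ) -
        ∫ σ, (meetings r B σ : ℝ) ∂seatingLaw N|} := by
    refine measureReal_mono (fun σ hσ => ?_) (measure_ne_top _ _)
    have hσ : r * B.card ^ 2 / N + a ≤ (meetings r B σ : ℝ) := hσ
    change a ≤ _
    have := integral_meetings_le B hr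
    exact le_trans (by linarith) (le_abs_self _)
  refine h1.trans ((ENNReal.toReal_le_of_le_ofReal ?_ h).trans ?_)
  · exact div_nonneg (variance_nonneg _ _) (sq_nonneg _)
  · gcongr
    exact variance_meetings_le B hr

/-- At most `r` agents share a room with a given pair of members of `B`. -/
theorem card_filter_two_le_believersInRoom_le (hr : 0 < r) (σ : Equiv.Perm (Fin N)) :
    (Finset.univ.filter fun i => 2 ≤ believersInRoom r B σ i).card ≤ meetings r B σ * r := by
  classical
  have hsub : (Finset.univ.filter fun i => 2 ≤ believersInRoom r B σ i) ⊆
      ((roomPairs N r).filter fun e => σ.symm e.1 ∈ B ∧ σ.symm e.2 ∈ B).biUnion fun e =>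
        Finset.univ.filter fun i => room r σ i = (e.1 : ℕ) / r := by
    intro i hi
    obtain ⟨j, hj, j', hj', hne⟩ := Finset.one_lt_card.1 (Finset.mem_filter.1 hi).2
    have hj := Finset.mem_filter.1 hj
    have hj' := Finset.mem_filter.1 hj'
    refine Finset.mem_biUnion.2 ⟨(σ j, σ j'), ?_, ?_⟩
    · refine Finset.mem_filter.2 ⟨Finset.mem_filter.2 ⟨Finset.mem_univ _, ?_, ?_⟩, ?_⟩
      · simpa using hne
      · exact hj.2.trans hj'.2.symm
      · simpa using ⟨hj.1, hj'.1⟩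
    · exact Finset.mem_filter.2 ⟨Finset.mem_univ _, hj.2.symm⟩
  exact (Finset.card_le_card hsub).trans
    (Finset.card_biUnion_le_card_mul _ _ _ fun e _ => card_agents_of_room_le hr _ _)

end RoomPairs

/-! ### One round below the critical density if two Believers are needed -/

section Extinction

variable {N m r : ℕ} {K : Community N} {B : Finset (Fin N)}

theorem Community.card_nextBelievers_sdiff_seeds_le (hr : 0 < r) (hm : 2 ≤ m)
    (o : RoundOutcome N) :
    (K.nextBelievers m r B o \ K.seeds).card ≤
      (survivors (B \ K.seeds) o.2).card + meetings r B o.1 * r := by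
  have hsub : K.nextBelievers m r B o \ K.seeds ⊆ survivors (B \ K.seeds) o.2 ∪
      Finset.univ.filter fun i => 2 ≤ believersInRoom r B o.1 i := by
    intro i hi
    obtain ⟨hi, his⟩ := Finset.mem_sdiff.1 hi
    rcases Finset.mem_union.1 hi with h | h
    · exact absurd h his
    · rcases (Finset.mem_filter.1 h).2 with h | h
      · exact Finset.mem_union_left _
          (Finset.mem_filter.2 ⟨Finset.mem_sdiff.2 ⟨h.1, his⟩, h.2⟩)
      · exact Finset.mem_union_right _
          (Finset.mem_filter.2 ⟨Finset.mem_univ _, hm.trans h.2⟩)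
  refine (Finset.card_le_card hsub).trans ((Finset.card_union_le _ _).trans ?_)
  exact Nat.add_le_add_left (card_filter_two_le_believersInRoom_le B hr o.1) _

theorem integral_card_nextBelievers_sdiff_seeds_le (d : unitInterval) (hr : 0 < r) (hm : 2 ≤ m) :
    ∫ o, ((K.nextBelievers m r B o \ K.seeds).card : ℝ) ∂roundLaw N d ≤
      (1 - d : ℝ) * (B \ K.seeds).card + r ^ 2 * B.card ^ 2 / N := by
  have hpt (o : RoundOutcome N) : ((K.nextBelievers m r B o \ K.seeds).card : ℝ) ≤
      (survivors (B \ K.seeds) o.2).card + meetings r B o.1 * r := by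
    exact_mod_cast Community.card_nextBelievers_sdiff_seeds_le hr hm o
  refine (integral_mono .of_finite .of_finite hpt).trans ?_
  rw [integral_add .of_finite .of_finite, integral_mul_const, roundLaw_eq,
    integral_fun_snd (fun c => ((survivors (B \ K.seeds) c).card : ℝ)),
    integral_fun_fst (fun σ => (meetings r B σ : ℝ)), integral_card_survivors,
    probReal_univ, probReal_univ, one_smul, one_smul]
  have := mul_le_mul_of_nonneg_right (integral_meetings_le B hr) (Nat.cast_nonneg (α := ℝ) r)
  have h2 : (r : ℝ) * B.card ^ 2 / N * r = r ^ 2 * B.card ^ 2 / N := by ring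
  linarith

/-- A fraction of Believers that is too small to sustain the rumor if two Believers in a room are
needed. -/
noncomputable def subcriticalFraction (r : ℕ) (d : unitInterval) : ℝ := d / (8 * r ^ 2)

theorem subcriticalFraction_pos (hr : 0 < r) {d : unitInterval} (hd : (0 : ℝ) < d) :
    0 < subcriticalFraction r d := by
  rw [subcriticalFraction]; positivity

theorem sq_mul_subcriticalFraction (hr : 0 < r) (d : unitInterval) :
    (r : ℝ) ^ 2 * subcriticalFraction r d = d / 8 := by
  have : (r : ℝ) ≠ 0 := by positivity
  rw [subcriticalFraction]; field_simp

theorem integral_card_nextBelievers_sdiff_seeds_le_mul {s : ℕ} (d : unitInterval) (hr : 0 < r)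
    (hm : 2 ≤ m) (hK : K.seeds.card = s) (hN : 0 < N) (hNs : 8 * (r : ℝ) ^ 2 * s ^ 2 ≤ d * N)
    (hsub : K.seeds ⊆ B) (hne : B ≠ K.seeds) (hB : (B.card : ℝ) ≤ subcriticalFraction r d * N) :
    ∫ o, ((K.nextBelievers m r B o \ K.seeds).card : ℝ) ∂roundLaw N d ≤
      (1 - d / 2 : ℝ) * (B \ K.seeds).card := by
  refine (integral_card_nextBelievers_sdiff_seeds_le d hr hm).trans ?_
  have hN' : (0 : ℝ) < N := by exact_mod_cast hN
  have hd0 : (0 : ℝ) ≤ d := d.2.1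
  set y : ℝ := ((B \ K.seeds).card : ℝ) with hy
  have hy1 : 1 ≤ y := by
    have : (B \ K.seeds).Nonempty := by
      rw [Finset.sdiff_nonempty]
      exact fun h => hne (h.antisymm hsub)
    rw [hy]; exact_mod_cast this.card_pos
  have hcard : (B.card : ℝ) = s + y := by
    have := Finset.card_sdiff_add_card_eq_card hsub
    rw [hy, ← hK, ← this]; push_cast; ring
  have hs0 : (0 : ℝ) ≤ s := Nat.cast_nonneg s
  -- Uses (s + y)² ≤ 2s² + 2y². After division by N each of the two terms is at most (d/4)y: the
  -- first because N is large and y ≥ 1, the second by the choice of the fraction. Together they use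
  -- up half of the loss dy.
  have h1 : (r : ℝ) ^ 2 * (B.card : ℝ) ^ 2 ≤ 2 * r ^ 2 * s ^ 2 + 2 * (r ^ 2 * y) * y := by
    rw [hcard]
    have h2 := mul_nonneg (sq_nonneg (r : ℝ)) (sq_nonneg ((s : ℝ) - y))
    nlinarith
  have h3 : (r : ℝ) ^ 2 * y ≤ d / 8 * N := by
    rw [← sq_mul_subcriticalFraction hr d, mul_assoc]
    exact mul_le_mul_of_nonneg_left (by linarith) (by positivity)
  have h4 := mul_le_mul_of_nonneg_right h3 (by linarith : (0 : ℝ) ≤ y)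
  have h5 : (d : ℝ) * N ≤ d * N * y := le_mul_of_one_le_right (by positivity) hy1
  have h6 : (r : ℝ) ^ 2 * B.card ^ 2 / N ≤ d / 2 * y := by
    rw [div_le_iff₀ hN']
    nlinarith
  linarith

theorem real_card_nextBelievers_gt_le {s : ℕ} (d : unitInterval) (hd : (0 : ℝ) < d) (hr : 0 < r)
    (hm : 2 ≤ m) (hK : K.seeds.card = s) (hN : 0 < N)
    (hNs : 8 * (s : ℝ) ≤ d * (subcriticalFraction r d * N))
    (hB : (B.card : ℝ) ≤ subcriticalFraction r d * N) :
    (roundLaw N d).real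
        {o | subcriticalFraction r d * N < ((K.nextBelievers m r B o).card : ℝ)} ≤
      16 * (1 + r ^ 5) / (d * subcriticalFraction r d) ^ 2 / N := by
  have hN' : (0 : ℝ) < N := by exact_mod_cast hN
  have hr' : (0 : ℝ) < r := by exact_mod_cast hr
  have hα := subcriticalFraction_pos hr hd
  have hd1 : (d : ℝ) ≤ 1 := d.2.2
  have hrα := sq_mul_subcriticalFraction hr d
  set α := subcriticalFraction r d
  -- The deviation allowed to survivors and to recruits. With s ≤ dαN/8 Seeds and a mean number of
  -- recruits of at most dαN/8, the total stays at most (1 - d/4)αN; both Chebyshev bounds are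
  -- O(1/N) since `a` is linear in N.
  set a : ℝ := d * α * N / 4 with ha
  have ha0 : 0 < a := by positivity
  set S := B \ K.seeds
  have hSB : (S.card : ℝ) ≤ B.card := by exact_mod_cast Finset.card_le_card Finset.sdiff_subset
  have hSN : (S.card : ℝ) ≤ N := by
    exact_mod_cast (Finset.card_le_univ S).trans (by simp)
  let E₁ : Set (RoundOutcome N) :=
    Set.univ ×ˢ {c | (1 - d : ℝ) * S.card + a ≤ ((survivors S c).card : ℝ)}
  let E₂ : Set (RoundOutcome N) :=
    {σ | r * B.card ^ 2 / N + a / r ≤ (meetings r B σ : ℝ)} ×ˢ Set.univ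
  have hsub : {o | α * N < ((K.nextBelievers m r B o).card : ℝ)} ⊆ E₁ ∪ E₂ := by
    intro o ho
    by_contra hno
    simp only [Set.mem_union, not_or, E₁, E₂, Set.mem_prod, Set.mem_univ, true_and, and_true] at hno
    have h1 : ((survivors S o.2).card : ℝ) < (1 - d : ℝ) * S.card + a := not_le.1 hno.1
    have h2 : (meetings r B o.1 : ℝ) < r * B.card ^ 2 / N + a / r := not_le.1 hno.2
    have h3 : ((K.nextBelievers m r B o).card : ℝ) ≤
        s + ((survivors S o.2).card + meetings r B o.1 * r) := by
      have h4 := Community.card_nextBelievers_sdiff_seeds_le (K := K) (B := B) hr hm o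
      have h5 := Finset.card_sdiff_add_card_eq_card
        (show K.seeds ⊆ K.nextBelievers m r B o from Finset.subset_union_left)
      rw [hK] at h5
      change _ ≤ (survivors S o.2).card + _ at h4
      have : (K.nextBelievers m r B o).card ≤
          s + ((survivors S o.2).card + meetings r B o.1 * r) := by omega
      exact_mod_cast this
    have h6 : (meetings r B o.1 : ℝ) * r ≤ r ^ 2 * B.card ^ 2 / N + a := by
      have := mul_le_mul_of_nonneg_right h2.le hr'.le
      refine this.trans (le_of_eq ?_)
      field_simp
    have h7 : (r : ℝ) ^ 2 * B.card ^ 2 / N ≤ d / 8 * (α * N) := by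
      rw [div_le_iff₀ hN', ← hrα]
      have := pow_le_pow_left₀ (Nat.cast_nonneg B.card) hB 2
      calc _ ≤ (r : ℝ) ^ 2 * (α * N) ^ 2 := mul_le_mul_of_nonneg_left this (by positivity)
        _ = _ := by ring
    have h8 : (1 - d : ℝ) * S.card ≤ (1 - d) * (α * N) :=
      mul_le_mul_of_nonneg_left (hSB.trans hB) (by linarith)
    have h9 : α * N < ((K.nextBelievers m r B o).card : ℝ) := ho
    have h10 : 0 < d * (α * N) := by positivity
    nlinarith
  refine (measureReal_mono hsub (measure_ne_top _ _)).trans ((measureReal_union_le _ _).trans ?_)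
  have h1 : (roundLaw N d).real E₁ ≤ N / a ^ 2 := by
    rw [roundLaw_eq, measureReal_prod_prod, probReal_univ, one_mul]
    exact (real_le_card_survivors_le d S ha0).trans (by gcongr)
  have h2 : (roundLaw N d).real E₂ ≤ N * r ^ 3 / (a / r) ^ 2 := by
    rw [roundLaw_eq, measureReal_prod_prod, probReal_univ, mul_one]
    exact real_le_meetings_le B hr (by positivity)
  refine (add_le_add h1 h2).trans (le_of_eq ?_)
  rw [ha]
  field_simp
  ring

end Extinction

/-! ### Time to die out -/

/-- Extinction within `O(log N)` rounds if two Believers in a room are needed and few agents believe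
initially. -/
theorem aas_dieOut (m r : ℕ) (d : unitInterval) (hd : (0 : ℝ) < d) (hr : 0 < r) (hm : 2 ≤ m)
    (s : ℕ) :
    AAS r s d (fun N N₀ => (N₀ : ℝ) ≤ subcriticalFraction r d * N) (fun {N} K B₀ ω =>
      ∃ t : ℕ, (t : ℝ) ≤ 2 / (1 - (1 - d / 2)) * Real.log N ∧ K.DiedOutAt m r B₀ ω t) := by
  intro ε hε
  have hd1 : (d : ℝ) ≤ 1 := d.2.2
  have hα := subcriticalFraction_pos hr hd
  set α := subcriticalFraction r d
  set H : ℝ := 16 * (1 + r ^ 5) / (d * α) ^ 2 with hH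
  have hH0 : 0 ≤ H := by positivity
  have hNat : Tendsto (fun N : ℕ => (N : ℝ)) atTop atTop := tendsto_natCast_atTop_atTop
  have hlog : Tendsto (fun N : ℕ => Real.log N / N) atTop (nhds 0) :=
    Real.isLittleO_log_id_atTop.tendsto_div_nhds_zero.comp hNat
  have hlim : Tendsto (fun N : ℕ => Real.exp 1 / (N : ℝ) +
      2 / (1 - (1 - d / 2)) * H * (Real.log N / N)) atTop (nhds 0) := by
    simpa using (tendsto_const_div_atTop_nhds_zero_nat (Real.exp 1)).add
      (hlog.const_mul (2 / (1 - (1 - d / 2 : ℝ)) * H))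
  filter_upwards [hlim.eventually_le_const hε, eventually_gt_atTop 0,
    (hNat.const_mul_atTop hd).eventually_ge_atTop (8 * (r : ℝ) ^ 2 * s ^ 2),
    ((hNat.const_mul_atTop hα).const_mul_atTop hd).eventually_ge_atTop (8 * (s : ℝ))]
    with N hN hN0 hNs hNs' b K B₀ hK hB₀
  let D : Set (Finset (Fin N)) := {K.seeds}
  let G : Set (Finset (Fin N)) := {B | K.IsBelieverSet B ∧ (B.card : ℝ) ≤ α * N}
  have hγ0 : (0 : ℝ) ≤ 1 - d / 2 := by linarith
  have hγ1 : (1 - d / 2 : ℝ) < 1 := by linarith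
  -- The contraction holds only in `G`, below density α. Leaving `G` costs H/N per round, hence
  -- O(log N / N) over the whole horizon.
  have hmain := real_chain_avoids_le (roundLaw N d) (K.nextBelievers m r) D G
    (fun B => ((B \ K.seeds).card : ℝ)) (1 - d / 2) (H / N) hγ0 (by positivity)
    (fun B => by positivity)
    (fun B hB hBD => by
      have : (B \ K.seeds).Nonempty := by
        rw [Finset.sdiff_nonempty]
        exact fun h => hBD (h.antisymm hB.1.1)
      exact_mod_cast this.card_pos)
    (fun B hB hBD => integral_card_nextBelievers_sdiff_seeds_le_mul d hr hm hK.card_seeds hN0 hNs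
      hB.1.1 hBD hB.2)
    (fun B hB _ => by
      refine le_trans (measureReal_mono (fun o ho => ?_) (measure_ne_top _ _))
        (real_card_nextBelievers_gt_le (m := m) d hd hr hm hK.card_seeds hN0 hNs' hB.2)
      by_contra hle
      exact ho ⟨Community.isBelieverSet_nextBelievers o, not_lt.1 hle⟩)
    (horizon (1 - d / 2) N) B₀ ⟨hK.isBelieverSet, hB₀⟩
  refine one_sub_le_real_of_compl_subset (processLaw N d)
    (A := {ω | ∀ t ≤ horizon (1 - d / 2) N, chain (K.nextBelievers m r) B₀ ω t ∉ D})
    (measurableSet_chain_avoids _ _ _ _) ?_ ?_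
  · refine hmain.trans (le_trans (add_le_add ?_ ?_) hN)
    · refine le_trans ?_ (pow_horizon_mul_le hγ0 hγ1 hN0)
      refine mul_le_mul_of_nonneg_left ?_ (by positivity)
      exact_mod_cast (Finset.card_le_univ (B₀ \ K.seeds)).trans (by simp)
    · refine (mul_le_mul_of_nonneg_right (horizon_le hγ1 N) (by positivity)).trans (le_of_eq ?_)
      ring
  · intro ω hω
    have hω : ¬ ∀ t ≤ horizon (1 - d / 2) N, chain (K.nextBelievers m r) B₀ ω t ∉ D := hω
    push Not at hω
    obtain ⟨t, ht, htD⟩ := hω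
    refine ⟨t, le_trans (by exact_mod_cast ht) (horizon_le hγ1 N), ?_⟩
    rw [Community.DiedOutAt, believers_eq_chain]
    exact htD

end RumorSpreading

/-! ### Choice of the constants -/

theorem theorem1 (r : ℕ) (d : unitInterval) (hd_pos : (0 : ℝ) < d) (hd_le : (d : ℝ) ≤ 0.1) :
    -- one Believer in a room suffices
    (1 < r →
      ∃ C > (0 : ℝ), ∃ c > (0 : ℝ), ∀ s : ℕ, 1 ≤ s →
        -- take-over within `O(log N)` rounds
        RumorSpreading.AAS r s d (fun _ N₀ => s ≤ N₀)
          (fun {N} K B₀ ω => ∃ t : ℕ, (t : ℝ) ≤ C * Real.log N ∧ K.TakenOverAt 1 r B₀ ω t) ∧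
        -- tightness: no take-over before `Ω(log N)` rounds when only the Seeds believe initially
        RumorSpreading.AAS r s d (fun _ N₀ => N₀ = s)
          (fun {N} K B₀ ω => ∀ t : ℕ, K.TakenOverAt 1 r B₀ ω t → c * Real.log N ≤ (t : ℝ))) ∧
    -- at least two Believers in a room are needed
    (∃ α > (0 : ℝ), ∃ C > (0 : ℝ), ∃ c > (0 : ℝ), ∀ m s : ℕ, 2 ≤ m → m < r → m ≤ s →
        -- extinction within `O(log N)` rounds
        RumorSpreading.AAS r s d (fun N N₀ => (N₀ : ℝ) ≤ α * N)
          (fun {N} K B₀ ω => ∃ t : ℕ, (t : ℝ) ≤ C * Real.log N ∧ K.DiedOutAt m r B₀ ω t) ∧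
        -- tightness: no extinction before `Ω(log N)` rounds from a linear number of Believers
        ∀ β > (0 : ℝ), RumorSpreading.AAS r s d (fun N N₀ => β * N ≤ (N₀ : ℝ))
          (fun {N} K B₀ ω => ∀ t : ℕ, K.DiedOutAt m r B₀ ω t → c * Real.log N ≤ (t : ℝ))) := by
  have hd_lt : (d : ℝ) < 1 := by linarith
  refine ⟨fun hr => ⟨2 / (1 - 0.98), by norm_num, 1 / (2 * Real.log r), ?_, fun s hs =>
    ⟨RumorSpreading.aas_takeOver r d hd_le hr s hs,
      RumorSpreading.aas_not_takeOver_early r d hr s hs⟩⟩, ?_⟩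
  · have := Real.log_pos (show (1 : ℝ) < r by exact_mod_cast hr)
    positivity
  -- For `r` = 0 no `m` < `r` exists and any constants do; α would not be positive there.
  · rcases Nat.eq_zero_or_pos r with rfl | hr
    · exact ⟨1, one_pos, 1, one_pos, 1, one_pos, fun m s _ hm => absurd hm (Nat.not_lt_zero m)⟩
    · have hlog : Real.log (1 - d) < 0 := Real.log_neg (by linarith) (by linarith)
      refine ⟨RumorSpreading.subcriticalFraction r d,
        RumorSpreading.subcriticalFraction_pos hr hd_pos,
        2 / (1 - (1 - d / 2)), div_pos two_pos (by linarith),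
        1 / (-2 * Real.log (1 - d)), div_pos one_pos (by linarith), fun m s hm _ _ =>
        ⟨RumorSpreading.aas_dieOut m r d hd_pos hr hm s, fun β hβ =>
          RumorSpreading.aas_not_dieOut_early m r d hd_pos hd_lt s hβ⟩⟩
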